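/- **Theorem 1.1.** Let $d\ge 3$, put $g=\lfloor (d-1)/2\rfloor$, and let $W_0\subseteq \mathbb F_2^d$ be the subspace of vectors with coordinate sum $0$. Let $\bar V=W_0$ if $d$ is odd, and $\bar V=W_0/\langle (1,\dots,1)\rangle$ if $d$ is even; it has dimension $2g$. It carries the alternating pairing induced by the dot product $\langle v,w\rangle=\sum_i v_iw_i$, and the symmetric group $S_d$ acts on it by permuting coordinates and preserves this pairing (the standard representation $\rho : S_d\to \mathrm{Sp}(\bar V)$). Let $V$ be a free $\mathbb Z_2$-module of rank $2g$ with an alternating $\mathbb Z_2$-bilinear pairing $\langle\cdot,\cdot\rangle : V\times V\to\mathbb Z_2$, together with an identification $V/2V\cong\bar V$ under which the reduction modulo $2$ of the pairing on $V$ is the pairing on $\bar V$. Let $\mathrm{Sp}(V)$ be the group of automorphisms of $V$ preserving the pairing, with the $2$-adic topology. For $n\ge 1$ let $\varpi_{2^n}:\mathrm{Sp}(V)\to\mathrm{Sp}(V/2^nV)$ be the reduction map and $\Gamma(2^n)$ its kernel. Let $\mathfrak S_d\subseteq \mathrm{Sp}(V/2V)$ be the image of $S_d$ under $\rho$. Let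 $G\subseteq \mathrm{Sp}(V)$ be a closed subgroup with $\varpi_2(G)\supseteq \mathfrak S_d$. (a) If $d\ge 6$ is even, then $G=\varpi_2^{-1}(\varpi_2(G))$; thus $G$ is open in $\mathrm{Sp}(V)$ and $G\supseteq\Gamma(2)$. (b) If $d\ge 5$ is odd, then $G\supseteq \Gamma(8)$, and so $G$ is open in $\mathrm{Sp}(V)$. If moreover $\varpi_2(G)=\mathfrak S_d$ and $G\not\supseteq\Gamma(4)$, then $\#\varpi_8(G)=d!\cdot 2^{4g^2-2g}$. Any two closed subgroups $G,G'\subseteq\mathrm{Sp}(V)$ with $\varpi_2(G)=\varpi_2(G')=\mathfrak S_d$, neither of which contains $\Gamma(4)$, are conjugate by an element of $\varpi_2^{-1}(\mathfrak S_d)$. -/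

import Mathlib

open scoped Topology

/-! ### Symplectic groups -/

/-- The group `Sp(M)` of `R`-linear automorphisms of `M` which preserve the bilinear pairing `B`
(with values in an `R`-module `P`). -/
def Sp {R M P : Type*} [CommRing R] [AddCommGroup M] [Module R M] [AddCommGroup P] [Module R P]
    (B : M →ₗ[R] M →ₗ[R] P) : Subgroup (M ≃ₗ[R] M) where
  carrier := {f | ∀ v w, B (f v) (f w) = B v w}
  mul_mem' := by
    intro f k hf hk v w
    simp only [LinearEquiv.mul_apply]
    rw [hf, hk]
  one_mem' := by intro v w; rfl
  inv_mem' := by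
    intro f hf v w
    have h := hf (f⁻¹ v) (f⁻¹ w)
    have e : ∀ x, f (f⁻¹ x) = x := fun x => LinearEquiv.apply_symm_apply f x
    rw [e, e] at h
    exact h.symm

/-! ### The standard representation of the symmetric group over the field with two elements -/

/-- The `S_d`-invariant subspace `W_0` of `W = 𝔽₂^d` of vectors with coordinate sum `0`. -/
def sumZero (d : ℕ) : Submodule (ZMod 2) (Fin d → ZMod 2) where
  carrier := {w | ∑ i, w i = 0}
  add_mem' := by
    intro a b ha hb
    simp only [Set.mem_ofPred_eq, Pi.add_apply, Finset.sum_add_distrib] at *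
    rw [ha, hb, add_zero]
  zero_mem' := by simp
  smul_mem' := by
    intro c x hx
    simp only [Set.mem_ofPred_eq, Pi.smul_apply, ← Finset.smul_sum] at *
    rw [hx, smul_zero]

/-- The intersection of `W_0` with the line spanned by the all-ones vector `w_0`.  It is the
line spanned by `w_0` if `d` is even, and it is zero if `d` is odd
(see `onesLine_eq_bot_of_odd`). -/
def onesLine (d : ℕ) : Submodule (ZMod 2) (sumZero d) :=
  (Submodule.span (ZMod 2) {(fun _ => 1 : Fin d → ZMod 2)}).comap (sumZero d).subtype

theorem mem_onesLine {d : ℕ} {w : sumZero d} :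
    w ∈ onesLine d ↔ ∃ c : ZMod 2, ∀ i, w.1 i = c := by
  unfold onesLine
  rw [Submodule.mem_comap, Submodule.mem_span_singleton]
  constructor
  · rintro ⟨c, hc⟩
    refine ⟨c, fun i => ?_⟩
    have := congrFun hc i
    simpa using this.symm
  · rintro ⟨c, hc⟩
    refine ⟨c, ?_⟩
    funext i
    simpa using (hc i).symm

theorem onesLine_eq_bot_of_odd {d : ℕ} (hd : Odd d) : onesLine d = ⊥ := by
  rw [eq_bot_iff]
  intro w hw
  obtain ⟨c, hc⟩ := mem_onesLine.1 hw
  have h : ∑ i, w.1 i = 0 := w.2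
  have hd' : (d : ZMod 2) = 1 := (ZMod.natCast_eq_one_iff_odd).2 hd
  simp only [hc, Finset.sum_const, Finset.card_univ, Fintype.card_fin, nsmul_eq_mul, hd',
    one_mul] at h
  rw [Submodule.mem_bot]
  apply Subtype.ext
  funext i
  rw [hc i, h]
  rfl

/-- The space of the standard representation of `S_d` over `𝔽₂`: the space `W_0` for odd `d`, and
`W_0 / ⟨w_0⟩` for even `d`.  (For odd `d` the quotient is by the zero subspace.) -/
abbrev StdSpace (d : ℕ) : Type := sumZero d ⧸ onesLine d

/-- The dot product on `W_0`; for `v_I = ∑_{i ∈ I} e_i` it gives `⟨v_I, v_J⟩ = #(I ∩ J)` mod 2. -/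
def dotForm (d : ℕ) : sumZero d →ₗ[ZMod 2] sumZero d →ₗ[ZMod 2] ZMod 2 :=
  LinearMap.mk₂ (ZMod 2) (fun v w => ∑ i, v.1 i * w.1 i)
    (by intro a b c; simp [add_mul, Finset.sum_add_distrib])
    (by intro a b c; simp [mul_assoc, Finset.mul_sum])
    (by intro a b c; simp [mul_add, Finset.sum_add_distrib])
    (by intro a b c; simp [mul_left_comm, Finset.mul_sum])

theorem dotForm_apply {d : ℕ} (v w : sumZero d) : dotForm d v w = ∑ i, v.1 i * w.1 i := rfl

theorem dotForm_left {d : ℕ} {v : sumZero d} (hv : v ∈ onesLine d) (w : sumZero d) :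
    dotForm d v w = 0 := by
  obtain ⟨c, hc⟩ := mem_onesLine.1 hv
  have h : ∑ i, w.1 i = 0 := w.2
  simp only [dotForm_apply, hc, ← Finset.mul_sum, h, mul_zero]

theorem dotForm_right {d : ℕ} (v : sumZero d) {w : sumZero d} (hw : w ∈ onesLine d) :
    dotForm d v w = 0 := by
  obtain ⟨c, hc⟩ := mem_onesLine.1 hw
  have h : ∑ i, v.1 i = 0 := v.2
  simp only [dotForm_apply, hc, ← Finset.sum_mul, h, zero_mul]

/-- The alternating pairing on the space of the standard representation induced by the
dot product. -/
def stdForm (d : ℕ) : StdSpace d →ₗ[ZMod 2] StdSpace d →ₗ[ZMod 2] ZMod 2 :=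
  (onesLine d).liftQ
    { toFun := fun v => (onesLine d).liftQ (dotForm d v) (fun _ hw => dotForm_right v hw)
      map_add' := by
        intro a b
        refine LinearMap.ext fun x => ?_
        obtain ⟨w, rfl⟩ := (onesLine d).mkQ_surjective x
        exact LinearMap.map_add₂ (dotForm d) a b w
      map_smul' := by
        intro c a
        refine LinearMap.ext fun x => ?_
        obtain ⟨w, rfl⟩ := (onesLine d).mkQ_surjective x
        exact LinearMap.map_smul₂ (dotForm d) c a w }
    (by
      intro v hv
      rw [LinearMap.mem_ker]
      refine LinearMap.ext fun x => ?_
      obtain ⟨w, rfl⟩ := (onesLine d).mkQ_surjective x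
      exact dotForm_left hv w)

theorem stdForm_mk {d : ℕ} (v w : sumZero d) :
    stdForm d ((onesLine d).mkQ v) ((onesLine d).mkQ w) = ∑ i, v.1 i * w.1 i := rfl

/-- The action of a permutation on `W_0`, which sends `e_i` to `e_{σ i}`. -/
def permSumZero {d : ℕ} (σ : Equiv.Perm (Fin d)) : sumZero d →ₗ[ZMod 2] sumZero d where
  toFun w := ⟨fun i => w.1 (σ⁻¹ i), by
    have h : ∑ i, w.1 i = 0 := w.2
    change ∑ i, w.1 (σ⁻¹ i) = 0
    rw [← h]
    exact Equiv.sum_comp σ⁻¹ w.1⟩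
  map_add' _ _ := rfl
  map_smul' _ _ := rfl

/-- The action of a permutation on the space of the standard representation. -/
def permStd {d : ℕ} (σ : Equiv.Perm (Fin d)) : StdSpace d →ₗ[ZMod 2] StdSpace d :=
  (onesLine d).mapQ (onesLine d) (permSumZero σ) (by
    intro w hw
    obtain ⟨c, hc⟩ := mem_onesLine.1 hw
    exact mem_onesLine.2 ⟨c, fun i => hc (σ⁻¹ i)⟩)

theorem permStd_mk {d : ℕ} (σ : Equiv.Perm (Fin d)) (w : sumZero d) :
    permStd σ ((onesLine d).mkQ w) = (onesLine d).mkQ (permSumZero σ w) := rfl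

theorem permStd_mul {d : ℕ} (σ τ : Equiv.Perm (Fin d)) (x : StdSpace d) :
    permStd (σ * τ) x = permStd σ (permStd τ x) := by
  obtain ⟨w, rfl⟩ := (onesLine d).mkQ_surjective x
  simp only [permStd_mk]
  congr 1

theorem permStd_one {d : ℕ} (x : StdSpace d) : permStd (1 : Equiv.Perm (Fin d)) x = x := by
  obtain ⟨w, rfl⟩ := (onesLine d).mkQ_surjective x
  rfl

theorem stdForm_permStd {d : ℕ} (σ : Equiv.Perm (Fin d)) (x y : StdSpace d) :
    stdForm d (permStd σ x) (permStd σ y) = stdForm d x y := by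
  obtain ⟨v, rfl⟩ := (onesLine d).mkQ_surjective x
  obtain ⟨w, rfl⟩ := (onesLine d).mkQ_surjective y
  rw [permStd_mk, permStd_mk, stdForm_mk, stdForm_mk]
  exact Equiv.sum_comp σ⁻¹ (fun i => v.1 i * w.1 i)

/-- The standard representation `ρ : S_d → Sp(StdSpace d)` over `𝔽₂`. -/
def stdRep (d : ℕ) : Equiv.Perm (Fin d) →* Sp (stdForm d) where
  toFun σ := ⟨LinearEquiv.ofLinearMap (permStd σ) (permStd σ⁻¹)
      (by
        refine LinearMap.ext fun x => ?_
        rw [LinearMap.comp_apply, ← permStd_mul, mul_inv_cancel, permStd_one, LinearMap.id_apply])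
      (by
        refine LinearMap.ext fun x => ?_
        rw [LinearMap.comp_apply, ← permStd_mul, inv_mul_cancel, permStd_one, LinearMap.id_apply]), stdForm_permStd σ⟩
  map_one' := by
    apply Subtype.ext
    apply LinearEquiv.ext
    exact permStd_one
  map_mul' σ τ := by
    apply Subtype.ext
    apply LinearEquiv.ext
    exact permStd_mul σ τ

/-! ### Reduction of a symplectic module over the 2-adic integers -/

section Reduction

variable {V : Type*} [AddCommGroup V] [Module ℤ_[2] V]

/-- The submodule `m V` of `V`. -/
noncomputable def multiples (V : Type*) [AddCommGroup V] [Module ℤ_[2] V] (m : ℕ) : Submodule ℤ_[2] V :=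
  LinearMap.range (LinearMap.lsmul ℤ_[2] V (m : ℤ_[2]))

theorem mem_multiples {m : ℕ} {v : V} : v ∈ multiples V m ↔ ∃ w : V, (m : ℤ_[2]) • w = v :=
  Iff.rfl

/-- The reduction `V / m V`. -/
abbrev Red (V : Type*) [AddCommGroup V] [Module ℤ_[2] V] (m : ℕ) : Type _ := V ⧸ multiples V m

/-- The pairing on `V / m V` induced by a pairing on `V`, with values in `ℤ₂ / m ℤ₂`. -/
noncomputable def redForm (B : V →ₗ[ℤ_[2]] V →ₗ[ℤ_[2]] ℤ_[2]) (m : ℕ) :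
    Red V m →ₗ[ℤ_[2]] Red V m →ₗ[ℤ_[2]] Red ℤ_[2] m :=
  (multiples V m).liftQ
    { toFun := fun v => (multiples V m).mapQ (multiples ℤ_[2] m) (B v) (by
        rintro _ ⟨w, rfl⟩
        exact ⟨B v w, by simp⟩)
      map_add' := by
        intro a b
        refine LinearMap.ext fun x => ?_
        obtain ⟨w, rfl⟩ := (multiples V m).mkQ_surjective x
        exact congrArg (multiples ℤ_[2] m).mkQ (LinearMap.map_add₂ B a b w)
      map_smul' := by
        intro c a
        refine LinearMap.ext fun x => ?_
        obtain ⟨w, rfl⟩ := (multiples V m).mkQ_surjective x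
        exact congrArg (multiples ℤ_[2] m).mkQ (LinearMap.map_smul₂ B c a w) }
    (by
      rintro _ ⟨v, rfl⟩
      rw [LinearMap.mem_ker]
      refine LinearMap.ext fun x => ?_
      obtain ⟨w, rfl⟩ := (multiples V m).mkQ_surjective x
      refine (Submodule.Quotient.mk_eq_zero (multiples ℤ_[2] m)).2 ⟨B v w, ?_⟩
      exact (LinearMap.map_smul₂ B (m : ℤ_[2]) v w).symm)

theorem redForm_mk (B : V →ₗ[ℤ_[2]] V →ₗ[ℤ_[2]] ℤ_[2]) (m : ℕ) (v w : V) :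
    redForm B m ((multiples V m).mkQ v) ((multiples V m).mkQ w)
      = (multiples ℤ_[2] m).mkQ (B v w) := rfl

theorem map_multiples (f : V ≃ₗ[ℤ_[2]] V) (m : ℕ) :
    multiples V m ≤ (multiples V m).comap (f : V →ₗ[ℤ_[2]] V) := by
  rintro _ ⟨w, rfl⟩
  exact ⟨f w, by simp⟩

/-- The endomorphism of `V / m V` induced by an automorphism of `V`. -/
noncomputable def redMap (f : V ≃ₗ[ℤ_[2]] V) (m : ℕ) : Red V m →ₗ[ℤ_[2]] Red V m :=
  (multiples V m).mapQ (multiples V m) (f : V →ₗ[ℤ_[2]] V) (map_multiples f m)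

theorem redMap_mk (f : V ≃ₗ[ℤ_[2]] V) (m : ℕ) (v : V) :
    redMap f m ((multiples V m).mkQ v) = (multiples V m).mkQ (f v) := rfl

theorem redMap_mul (f k : V ≃ₗ[ℤ_[2]] V) (m : ℕ) (x : Red V m) :
    redMap (f * k) m x = redMap f m (redMap k m x) := by
  obtain ⟨v, rfl⟩ := (multiples V m).mkQ_surjective x
  rfl

theorem redMap_one (m : ℕ) (x : Red V m) : redMap (1 : V ≃ₗ[ℤ_[2]] V) m x = x := by
  obtain ⟨v, rfl⟩ := (multiples V m).mkQ_surjective x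
  rfl

theorem redForm_redMap (B : V →ₗ[ℤ_[2]] V →ₗ[ℤ_[2]] ℤ_[2]) (m : ℕ) (f : Sp B) (x y : Red V m) :
    redForm B m (redMap f.1 m x) (redMap f.1 m y) = redForm B m x y := by
  obtain ⟨v, rfl⟩ := (multiples V m).mkQ_surjective x
  obtain ⟨w, rfl⟩ := (multiples V m).mkQ_surjective y
  rw [redMap_mk, redMap_mk, redForm_mk, redForm_mk, f.2 v w]

/-- The reduction map `ϖ_m : Sp(V) → Sp(V / m V)`.  Automorphisms of `V / m V` as a `ℤ₂`-module
are the same as automorphisms as a `ℤ / m`-module when `m` is a power of `2`. -/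
noncomputable def redSp (B : V →ₗ[ℤ_[2]] V →ₗ[ℤ_[2]] ℤ_[2]) (m : ℕ) : Sp B →* Sp (redForm B m) where
  toFun f := ⟨LinearEquiv.ofLinearMap (redMap f.1 m) (redMap f.1⁻¹ m)
      (by
        refine LinearMap.ext fun x => ?_
        rw [LinearMap.comp_apply, ← redMap_mul, mul_inv_cancel, redMap_one, LinearMap.id_apply])
      (by
        refine LinearMap.ext fun x => ?_
        rw [LinearMap.comp_apply, ← redMap_mul, inv_mul_cancel, redMap_one, LinearMap.id_apply]),
    redForm_redMap B m f⟩
  map_one' := by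
    apply Subtype.ext
    apply LinearEquiv.ext
    exact redMap_one m
  map_mul' f k := by
    apply Subtype.ext
    apply LinearEquiv.ext
    exact redMap_mul f.1 k.1 m

/-- The principal congruence subgroup `Γ(m)`, the kernel of the reduction `Sp(V) → Sp(V / m V)`. -/
noncomputable def Gam (B : V →ₗ[ℤ_[2]] V →ₗ[ℤ_[2]] ℤ_[2]) (m : ℕ) : Subgroup (Sp B) := (redSp B m).ker

/-- The 2-adic topology on `Sp(V)`: the coarsest topology for which all the reduction maps
`Sp(V) → Sp(V / 2^n V)` to discrete groups are continuous. -/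
@[reducible]
noncomputable def twoAdic (B : V →ₗ[ℤ_[2]] V →ₗ[ℤ_[2]] ℤ_[2]) : TopologicalSpace (Sp B) :=
  ⨅ n : ℕ, TopologicalSpace.induced (redSp B (2 ^ n)) ⊥

/-- The subgroup `𝔖_d` of `Sp(V / 2V)`: the automorphisms which correspond, under an
identification `e` of `V / 2V` with the space of the standard representation, to elements of the
image of the standard representation of `S_d`. -/
noncomputable def stdImage (B : V →ₗ[ℤ_[2]] V →ₗ[ℤ_[2]] ℤ_[2]) (d : ℕ) (e : Red V 2 ≃+ StdSpace d) :
    Subgroup (Sp (redForm B 2)) where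
  carrier := {f | ∃ s ∈ (stdRep d).range, ∀ x, e (f.1 x) = s.1 (e x)}
  mul_mem' := by
    rintro f k ⟨s, hs, h⟩ ⟨t, ht, h'⟩
    refine ⟨s * t, mul_mem hs ht, fun x => ?_⟩
    change e (f.1 (k.1 x)) = s.1 (t.1 (e x))
    rw [h, h']
  one_mem' := ⟨1, one_mem _, fun _ => rfl⟩
  inv_mem' := by
    rintro f ⟨s, hs, h⟩
    refine ⟨s⁻¹, inv_mem hs, fun x => ?_⟩
    have h1 := h ((f⁻¹).1 x)
    have h2 : f.1 ((f⁻¹).1 x) = x := LinearEquiv.apply_symm_apply f.1 x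
    rw [h2] at h1
    rw [h1]
    exact (LinearEquiv.symm_apply_apply s.1 _).symm

end Reduction

/-! ### The standard representation -/

section StandardRepresentation

variable {d : ℕ}

/-! Write V̄ for `StdSpace d`, v_ij for `pairVec i j`, x ⊗ x for `sqEnd x` and x ∧ y for `wedgeEnd x
y`. Filter G by congruence subgroups. An element 1 + 2^n A of Γ(2^n), n ≥ 1, has as symbol the
reduction of A modulo 2, a self-adjoint endomorphism of V̄. The symbols of G ∩ Γ(2^(n+1)) form a
group `layer e G n`, stable under conjugation by S_d. If all layers from n on are the whole of
`symEnd d`, successive approximation and closedness give Γ(2^(n+1)) ≤ G (`Gam_le_of_layers`).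
Squaring puts layer n inside layer n + 1 for n ≥ 1, so everything is decided by layers 0, 1 and 2.

As an S_d-module `symEnd d` has the submodule `altEnd d`, spanned by the x ∧ y, with quotient V̄.
The quotient map is the diagonal, sending X to the w with ⟨Xx, x⟩ = ⟨x, w⟩. A stable subgroup of
`symEnd d` that strictly contains `altEnd d` is everything (`PermStable.symEnd_le_of_not_altEnd`).

Transpositions act on V̄ as transvections, hence lift to transvections of V. The square of a lift in
G of a transposition forces `altEnd d` into layer 0 (`altEnd_le_layer_zero`). If layer 0 were only
alternating, squares and commutators of lifts would pin down the diagonals of those lifts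
(`diag_of_swap`), and summing coordinates would give d · c = 1 in 𝔽₂. This is absurd for even d and
proves (a). For odd d with layer 0 alternating, a commutator of lifts of two disjoint transpositions
forces `altEnd d` into layer 1 (`altEnd_le_layer_one`), and elements of G whose symbols are
projections show that layer 2 is not alternating (`layer_two_not_le_altEnd`). Hence Γ(8) ≤ G. If
Γ(4) is not in G, layers 0 and 1 are exactly `altEnd d`, and multiplying the sizes of the layers
gives the order.

For conjugacy, two such groups G and H are compared modulo 4 and then modulo 8. The obstruction at
each stage is a crossed homomorphism from G to V̄ = `symEnd d` / `altEnd d`. It factors through S_d,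
at the second stage because every equivariant map from `altEnd d` to V̄ vanishes
(`eq_zero_of_equivariant`). It is principal because H¹(S_d, V̄) = 0 for odd d
(`exists_of_crossedHom`), so conjugation by a transvection in the relevant congruence subgroup
removes it (`exists_conj_step`). After two stages Γ(8), contained in both groups, absorbs the
remaining error. -/

theorem zmod_two_cases (c : ZMod 2) : c = 0 ∨ c = 1 := by revert c; decide

theorem AddSubgroup.zmodTwo_smul_mem {M : Type*} [AddCommGroup M] [Module (ZMod 2) M]
    (N : AddSubgroup M) {x : M} (hx : x ∈ N) (c : ZMod 2) : c • x ∈ N := by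
  rcases zmod_two_cases c with rfl | rfl
  · rw [zero_smul]; exact N.zero_mem
  · rwa [one_smul]

theorem add_self_std (x : StdSpace d) : x + x = 0 := by
  rw [← two_smul (ZMod 2) x, show (2 : ZMod 2) = 0 from rfl, zero_smul]

theorem neg_std (x : StdSpace d) : -x = x := neg_eq_of_add_eq_zero_left (add_self_std x)

/-- The class `v_{ij}` of `e_i + e_j`. -/
def pairVec (i j : Fin d) : StdSpace d :=
  (onesLine d).mkQ ⟨Pi.single i 1 + Pi.single j 1, by
    change ∑ k, (Pi.single i 1 + Pi.single j 1 : Fin d → ZMod 2) k = 0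
    simp only [Pi.add_apply, Finset.sum_add_distrib, Finset.sum_pi_single', Finset.mem_univ,
      if_true]
    rfl⟩

theorem pairVec_comm (i j : Fin d) : pairVec i j = pairVec j i := by
  unfold pairVec
  congr 2
  exact add_comm _ _

theorem pairVec_self (i : Fin d) : pairVec i i = 0 := by
  unfold pairVec
  convert (onesLine d).mkQ.map_zero using 2
  apply Subtype.ext
  funext k
  exact CharTwo.add_self_eq_zero _

theorem pairVec_add (i j k : Fin d) : pairVec i j + pairVec j k = pairVec i k := by
  unfold pairVec
  rw [← map_add]
  congr 1
  apply Subtype.ext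
  funext l
  change (Pi.single i 1 + Pi.single j 1 : Fin d → ZMod 2) l
    + (Pi.single j 1 + Pi.single k 1 : Fin d → ZMod 2) l = (Pi.single i 1 + Pi.single k 1 : Fin d → ZMod 2) l
  simp only [Pi.add_apply]
  have := CharTwo.add_self_eq_zero ((Pi.single j 1 : Fin d → ZMod 2) l)
  linear_combination this

theorem pairVec_add' (i j k : Fin d) : pairVec i j + pairVec i k = pairVec j k := by
  rw [pairVec_comm i j, pairVec_add]

theorem stdForm_mk_pairVec (y : sumZero d) (i j : Fin d) :
    stdForm d ((onesLine d).mkQ y) (pairVec i j) = y.1 i + y.1 j := by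
  unfold pairVec
  rw [stdForm_mk]
  simp [mul_add, Finset.sum_add_distrib, Pi.single_apply]

theorem stdForm_comm (x y : StdSpace d) : stdForm d x y = stdForm d y x := by
  obtain ⟨v, rfl⟩ := (onesLine d).mkQ_surjective x
  obtain ⟨w, rfl⟩ := (onesLine d).mkQ_surjective y
  rw [stdForm_mk, stdForm_mk]
  exact Finset.sum_congr rfl fun i _ => mul_comm _ _

theorem stdForm_self (x : StdSpace d) : stdForm d x x = 0 := by
  obtain ⟨v, rfl⟩ := (onesLine d).mkQ_surjective x
  rw [stdForm_mk]
  have h : ∑ i, v.1 i = 0 := v.2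
  rw [← h]
  refine Finset.sum_congr rfl fun i _ => ?_
  generalize v.1 i = c
  revert c; decide

theorem stdForm_pairVec (i j k l : Fin d) :
    stdForm d (pairVec i j) (pairVec k l) =
      (if k = i then 1 else 0) + (if k = j then 1 else 0) +
        ((if l = i then 1 else 0) + (if l = j then 1 else 0)) := by
  conv_lhs => rw [pairVec]
  rw [stdForm_mk_pairVec]
  simp [Pi.single_apply]

theorem stdForm_pairVec_of_disjoint {i j k l : Fin d} (hik : i ≠ k) (hil : i ≠ l) (hjk : j ≠ k)
    (hjl : j ≠ l) : stdForm d (pairVec i j) (pairVec k l) = 0 := by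
  rw [stdForm_pairVec]
  simp [hik.symm, hil.symm, hjk.symm, hjl.symm]

theorem stdForm_pairVec_of_common {i j k : Fin d} (hij : i ≠ j) (hik : i ≠ k) (hjk : j ≠ k) :
    stdForm d (pairVec i j) (pairVec i k) = 1 := by
  rw [stdForm_pairVec]
  simp [hij, hik.symm, hjk.symm]

theorem permStd_pairVec (σ : Equiv.Perm (Fin d)) (i j : Fin d) :
    permStd σ (pairVec i j) = pairVec (σ i) (σ j) := by
  unfold pairVec
  rw [permStd_mk]
  congr 1
  apply Subtype.ext
  funext k
  change (Pi.single i 1 + Pi.single j 1 : Fin d → ZMod 2) (σ⁻¹ k)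
    = (Pi.single (σ i) 1 + Pi.single (σ j) 1 : Fin d → ZMod 2) k
  simp only [Pi.add_apply, Pi.single_apply, Equiv.Perm.inv_eq_iff_eq]

/-- A transposition acts as the transvection along v_ij. This is what allows transpositions to be
lifted to integral transvections. -/
theorem permStd_swap (i j : Fin d) (x : StdSpace d) :
    permStd (Equiv.swap i j) x = x + stdForm d x (pairVec i j) • pairVec i j := by
  obtain ⟨v, rfl⟩ := (onesLine d).mkQ_surjective x
  rw [stdForm_mk_pairVec, permStd_mk]
  unfold pairVec
  rw [← map_smul, ← map_add]
  congr 1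
  apply Subtype.ext
  funext k
  change v.1 ((Equiv.swap i j)⁻¹ k) = v.1 k + (v.1 i + v.1 j) *
    (Pi.single i 1 + Pi.single j 1 : Fin d → ZMod 2) k
  rw [Equiv.swap_inv]
  simp only [Pi.add_apply, Pi.single_apply]
  rcases eq_or_ne k i with rfl | hki
  · rw [Equiv.swap_apply_left]
    rcases eq_or_ne k j with rfl | hkj
    · simp [CharTwo.add_self_eq_zero]
    · simp only [if_true, hkj, if_false, add_zero, mul_one]
      linear_combination -CharTwo.add_self_eq_zero (v.1 k)
  · rcases eq_or_ne k j with rfl | hkj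
    · rw [Equiv.swap_apply_right]
      simp only [if_true, hki, if_false, zero_add, mul_one]
      linear_combination -CharTwo.add_self_eq_zero (v.1 k)
    · simp [Equiv.swap_apply_of_ne_of_ne hki hkj, hki, hkj]

theorem permStd_inv_apply (σ : Equiv.Perm (Fin d)) (x : StdSpace d) :
    permStd σ⁻¹ (permStd σ x) = x := by
  rw [← permStd_mul, inv_mul_cancel, permStd_one]

theorem permStd_apply_inv (σ : Equiv.Perm (Fin d)) (x : StdSpace d) :
    permStd σ (permStd σ⁻¹ x) = x := by
  rw [← permStd_mul, mul_inv_cancel, permStd_one]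

theorem stdForm_permStd_left (σ : Equiv.Perm (Fin d)) (x y : StdSpace d) :
    stdForm d (permStd σ x) y = stdForm d x (permStd σ⁻¹ y) := by
  rw [← stdForm_permStd σ x, permStd_apply_inv]

/-- The terms in e_a add up to the coordinate sum of y, which is zero. So the v_ak, for any fixed a,
span V̄. -/
theorem mkQ_eq_sum_pairVec (y : sumZero d) (a : Fin d) :
    (onesLine d).mkQ y = ∑ k, y.1 k • pairVec a k := by
  unfold pairVec
  simp only [← map_smul]
  rw [← map_sum]
  congr 1
  apply Subtype.ext
  have hy : ∑ i, y.1 i = 0 := y.2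
  funext l
  have : ((∑ k, y.1 k • (⟨Pi.single a 1 + Pi.single k 1, by
    change ∑ k', (Pi.single a 1 + Pi.single k 1 : Fin d → ZMod 2) k' = 0
    simp only [Pi.add_apply, Finset.sum_add_distrib, Finset.sum_pi_single', Finset.mem_univ,
      if_true]
    rfl⟩ : sumZero d)).1 : Fin d → ZMod 2) l
      = ∑ k, y.1 k * (Pi.single a 1 + Pi.single k 1 : Fin d → ZMod 2) l := by
    rw [← Submodule.subtype_apply, map_sum, Finset.sum_apply]
    rfl
  rw [this]
  simp only [Pi.add_apply, mul_add, Finset.sum_add_distrib, ← Finset.sum_mul, hy, zero_mul, zero_add,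
    Pi.single_apply]
  simp

theorem mem_of_pairVec_mem (N : AddSubgroup (StdSpace d)) (a : Fin d)
    (h : ∀ k, pairVec a k ∈ N) (x : StdSpace d) : x ∈ N := by
  obtain ⟨v, rfl⟩ := (onesLine d).mkQ_surjective x
  rw [mkQ_eq_sum_pairVec v a]
  refine N.sum_mem fun k _ => ?_
  exact N.zmodTwo_smul_mem (h k) _

theorem eq_zero_of_stdForm_pairVec (x : StdSpace d) (h : ∀ i j, stdForm d x (pairVec i j) = 0) :
    x = 0 := by
  obtain ⟨v, rfl⟩ := (onesLine d).mkQ_surjective x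
  simp only [stdForm_mk_pairVec] at h
  rw [Submodule.mkQ_apply, Submodule.Quotient.mk_eq_zero, mem_onesLine]
  rcases Nat.eq_zero_or_pos d with rfl | hd
  · exact ⟨0, fun i => i.elim0⟩
  · refine ⟨v.1 ⟨0, hd⟩, fun i => ?_⟩
    exact CharTwo.add_eq_zero.1 (h i _)

theorem stdForm_nondegenerate (x : StdSpace d) (h : ∀ y, stdForm d x y = 0) : x = 0 :=
  eq_zero_of_stdForm_pairVec x fun _ _ => h _

end StandardRepresentation

/-! ### Endomorphisms of the standard representation -/

section Endomorphisms

variable {d : ℕ}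

/-- The endomorphism `y ↦ ⟨y, x⟩ x`. -/
def sqEnd (x : StdSpace d) : Module.End (ZMod 2) (StdSpace d) := ((stdForm d).flip x).smulRight x

/-- The endomorphism `z ↦ ⟨z, x⟩ y + ⟨z, y⟩ x`. -/
def wedgeEnd (x y : StdSpace d) : Module.End (ZMod 2) (StdSpace d) :=
  ((stdForm d).flip x).smulRight y + ((stdForm d).flip y).smulRight x

theorem sqEnd_apply (x y : StdSpace d) : sqEnd x y = stdForm d y x • x := rfl

theorem wedgeEnd_apply (x y z : StdSpace d) :
    wedgeEnd x y z = stdForm d z x • y + stdForm d z y • x := rfl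

theorem wedgeEnd_comm (x y : StdSpace d) : wedgeEnd x y = wedgeEnd y x := add_comm _ _

theorem add_self_end (X : Module.End (ZMod 2) (StdSpace d)) : X + X = 0 :=
  LinearMap.ext fun _ => add_self_std _

theorem neg_end (X : Module.End (ZMod 2) (StdSpace d)) : -X = X :=
  neg_eq_of_add_eq_zero_left (add_self_end X)

theorem wedgeEnd_self (x : StdSpace d) : wedgeEnd x x = 0 := add_self_end _

theorem wedgeEnd_add_right (x y z : StdSpace d) :
    wedgeEnd x (y + z) = wedgeEnd x y + wedgeEnd x z := by
  refine LinearMap.ext fun w => ?_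
  simp only [LinearMap.add_apply, wedgeEnd_apply, map_add, smul_add, add_smul]
  abel

theorem wedgeEnd_add_left (x y z : StdSpace d) :
    wedgeEnd (x + y) z = wedgeEnd x z + wedgeEnd y z := by
  rw [wedgeEnd_comm, wedgeEnd_add_right, wedgeEnd_comm z, wedgeEnd_comm z]

theorem wedgeEnd_zero_right (x : StdSpace d) : wedgeEnd x 0 = 0 := by
  exact LinearMap.ext fun w => by simp [wedgeEnd_apply]

theorem wedgeEnd_zero_left (x : StdSpace d) : wedgeEnd 0 x = 0 := by
  rw [wedgeEnd_comm, wedgeEnd_zero_right]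

theorem sqEnd_zero : sqEnd (0 : StdSpace d) = 0 :=
  LinearMap.ext fun w => by simp [sqEnd_apply]

theorem sqEnd_add (x y : StdSpace d) : sqEnd (x + y) = sqEnd x + sqEnd y + wedgeEnd x y := by
  refine LinearMap.ext fun w => ?_
  simp only [LinearMap.add_apply, sqEnd_apply, wedgeEnd_apply, map_add, smul_add, add_smul]
  abel

/-- The self-adjoint endomorphisms: the Lie algebra of the symplectic group. -/
def symEnd (d : ℕ) : AddSubgroup (Module.End (ZMod 2) (StdSpace d)) where
  carrier := {X | ∀ x y, stdForm d (X x) y = stdForm d x (X y)}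
  add_mem' := by
    intro X Y hX hY x y
    simp only [LinearMap.add_apply, map_add, hX x y, hY x y]
  zero_mem' := by intro x y; simp
  neg_mem' := by intro X hX; rwa [neg_end]

/-- The endomorphisms `X` for which the form `⟨X x, y⟩` is alternating. -/
def altEnd (d : ℕ) : AddSubgroup (Module.End (ZMod 2) (StdSpace d)) where
  carrier := {X | ∀ x, stdForm d (X x) x = 0}
  add_mem' := by
    intro X Y hX hY x
    simp only [LinearMap.add_apply, map_add, hX x, hY x, add_zero]
  zero_mem' := by intro x; simp
  neg_mem' := by intro X hX; rwa [neg_end]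

theorem altEnd_le_symEnd : altEnd d ≤ symEnd d := by
  intro X hX x y
  have h := hX (x + y)
  simp only [map_add, LinearMap.add_apply, hX x, hX y, zero_add, add_zero] at h
  rw [stdForm_comm x]
  exact (CharTwo.add_eq_zero.1 h).symm

theorem sqEnd_mem_symEnd (x : StdSpace d) : sqEnd x ∈ symEnd d := by
  intro y z
  simp only [sqEnd_apply, map_smul, LinearMap.smul_apply, smul_eq_mul]
  rw [stdForm_comm x z, mul_comm]

theorem wedgeEnd_mem_altEnd (x y : StdSpace d) : wedgeEnd x y ∈ altEnd d := by
  intro z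
  simp only [wedgeEnd_apply, map_smul, LinearMap.smul_apply, smul_eq_mul, map_add,
    LinearMap.add_apply]
  rw [stdForm_comm x z, stdForm_comm y z, mul_comm, CharTwo.add_self_eq_zero]

theorem exists_stdForm_eq (f : StdSpace d →ₗ[ZMod 2] ZMod 2) :
    ∃ x, ∀ y, f y = stdForm d y x := by
  have hinj : Function.Injective (stdForm d).flip := by
    rw [injective_iff_map_eq_zero]
    intro x hx
    refine stdForm_nondegenerate x fun y => ?_
    rw [stdForm_comm]
    exact LinearMap.congr_fun hx y
  have hsurj := (LinearMap.injective_iff_surjective_of_finrank_eq_finrank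
    (f := (stdForm d).flip) (by
      rw [Module.finrank_linearMap]; simp)).1 hinj
  obtain ⟨x, hx⟩ := hsurj f
  exact ⟨x, fun y => (LinearMap.congr_fun hx y).symm⟩

/-- The diagonal of a self-adjoint endomorphism. -/
theorem exists_diag {X : Module.End (ZMod 2) (StdSpace d)} (hX : X ∈ symEnd d) :
    ∃ w, ∀ x, stdForm d (X x) x = stdForm d x w := by
  let f : StdSpace d →+ ZMod 2 :=
    { toFun := fun x => stdForm d (X x) x
      map_zero' := by simp
      map_add' := by
        intro x y
        simp only [map_add, LinearMap.add_apply]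
        rw [hX x y, stdForm_comm x (X y)]
        linear_combination CharTwo.add_self_eq_zero (stdForm d (X y) x) }
  obtain ⟨w, hw⟩ := exists_stdForm_eq (f.toZModLinearMap 2)
  exact ⟨w, hw⟩

theorem stdForm_sqEnd (x y : StdSpace d) : stdForm d (sqEnd x y) y = stdForm d y x := by
  rw [sqEnd_apply, map_smul, LinearMap.smul_apply, stdForm_comm x y]
  generalize stdForm d y x = c
  revert c; decide

/-- The endomorphism w ⊗ w has diagonal w, so it represents the class of X modulo the alternating
endomorphisms. -/
theorem add_sqEnd_mem_altEnd {X : Module.End (ZMod 2) (StdSpace d)} {w : StdSpace d}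
    (hw : ∀ x, stdForm d (X x) x = stdForm d x w) : X + sqEnd w ∈ altEnd d := by
  intro x
  rw [LinearMap.add_apply, map_add, LinearMap.add_apply, hw, stdForm_sqEnd,
    CharTwo.add_self_eq_zero]

section Basis

variable {ι : Type*} [LinearOrder ι]

theorem exists_dual_basis (b : Module.Basis ι (ZMod 2) (StdSpace d)) :
    ∃ c : ι → StdSpace d, ∀ i j, stdForm d (b i) (c j) = if i = j then 1 else 0 := by
  have h : ∀ j, ∃ x, ∀ y, b.coord j y = stdForm d y x := fun j => exists_stdForm_eq (b.coord j)
  choose c hc using h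
  refine ⟨c, fun i j => ?_⟩
  rw [← hc, Module.Basis.coord_apply, Module.Basis.repr_self, Finsupp.single_apply]

theorem altEnd_ext (b : Module.Basis ι (ZMod 2) (StdSpace d))
    {X Y : Module.End (ZMod 2) (StdSpace d)} (hX : X ∈ altEnd d) (hY : Y ∈ altEnd d)
    (h : ∀ i j, i < j → stdForm d (X (b i)) (b j) = stdForm d (Y (b i)) (b j)) : X = Y := by
  have hall : ∀ i j, stdForm d (X (b i)) (b j) = stdForm d (Y (b i)) (b j) := by
    intro i j
    rcases lt_trichotomy i j with hij | rfl | hij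
    · exact h i j hij
    · rw [hX, hY]
    · rw [altEnd_le_symEnd hX, altEnd_le_symEnd hY, stdForm_comm, stdForm_comm (b i)]
      exact h j i hij
  have : (stdForm d).comp X = (stdForm d).comp Y :=
    b.ext fun i => b.ext fun j => hall i j
  refine LinearMap.ext fun x => ?_
  rw [← sub_eq_zero]
  refine stdForm_nondegenerate _ fun y => ?_
  rw [map_sub, LinearMap.sub_apply, sub_eq_zero]
  exact LinearMap.congr_fun (LinearMap.congr_fun this x) y

variable [Fintype ι]

/-- Together with `altEnd_ext` this makes the wedges of a dual basis a basis of `altEnd d`, with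
coordinates the entries above the diagonal. -/
theorem stdForm_sum_wedgeEnd (b : Module.Basis ι (ZMod 2) (StdSpace d)) {c : ι → StdSpace d}
    (hc : ∀ i j, stdForm d (b i) (c j) = if i = j then 1 else 0)
    (f : {p : ι × ι // p.1 < p.2} → ZMod 2) (k l : ι) (hkl : k < l) :
    stdForm d ((∑ p, f p • wedgeEnd (c p.1.1) (c p.1.2)) (b k)) (b l) = f ⟨(k, l), hkl⟩ := by
  rw [LinearMap.sum_apply, map_sum, LinearMap.sum_apply]
  rw [Finset.sum_eq_single ⟨(k, l), hkl⟩]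
  · simp [wedgeEnd_apply, stdForm_comm (c _) (b _), hc, hkl.ne]
  · rintro ⟨⟨i, j⟩, hij⟩ _ hne
    have hij' : i < j := hij
    simp only [LinearMap.smul_apply, map_smul, wedgeEnd_apply, map_add, LinearMap.add_apply,
      stdForm_comm (c _) (b _), hc]
    by_cases h1 : k = i
    · subst h1
      have : l ≠ j := by rintro rfl; exact hne rfl
      simp [this, hij'.ne]
    · by_cases h2 : k = j
      · subst h2
        have : l ≠ i := by rintro rfl; exact lt_asymm hij' hkl
        simp [this, h1]
      · simp [h1, h2]
  · intro h; exact absurd (Finset.mem_univ _) h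

theorem sum_wedgeEnd_mem (M : AddSubgroup (Module.End (ZMod 2) (StdSpace d)))
    (c : ι → StdSpace d) (h : ∀ i j, wedgeEnd (c i) (c j) ∈ M)
    (f : {p : ι × ι // p.1 < p.2} → ZMod 2) :
    ∑ p, f p • wedgeEnd (c p.1.1) (c p.1.2) ∈ M :=
  M.sum_mem fun _ _ => M.zmodTwo_smul_mem (h _ _) _

end Basis

theorem altEnd_le_of_wedgeEnd_mem (M : AddSubgroup (Module.End (ZMod 2) (StdSpace d)))
    (h : ∀ x y, wedgeEnd x y ∈ M) : altEnd d ≤ M := by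
  intro X hX
  let b := Module.finBasis (ZMod 2) (StdSpace d)
  obtain ⟨c, hc⟩ := exists_dual_basis b
  have : X = ∑ p : {p : _ × _ // p.1 < p.2}, stdForm d (X (b p.1.1)) (b p.1.2) •
      wedgeEnd (c p.1.1) (c p.1.2) := by
    refine altEnd_ext b hX (sum_wedgeEnd_mem _ c (fun _ _ => wedgeEnd_mem_altEnd _ _) _) ?_
    intro k l hkl
    rw [stdForm_sum_wedgeEnd b hc (fun p => stdForm d (X (b p.1.1)) (b p.1.2)) k l hkl]
  rw [this]
  exact sum_wedgeEnd_mem M c (fun _ _ => h _ _) _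

theorem card_pairs_lt (n : ℕ) : Fintype.card {p : Fin n × Fin n // p.1 < p.2} = n.choose 2 := by
  rw [Fintype.card_subtype, Finset.card_filter, Fintype.sum_prod_type_right]
  have h : ∀ j : Fin n, ∑ i : Fin n, (if (i, j).1 < (i, j).2 then 1 else 0) = (j : ℕ) := by
    intro j
    rw [← Finset.card_filter]
    exact (congrArg Finset.card (by ext i; simp)).trans (Fin.card_Iio j)
  rw [Finset.sum_congr rfl fun j _ => h j, Fin.sum_univ_eq_sum_range (fun i => i) n,
    Finset.sum_range_id, Nat.choose_two_right]

theorem card_altEnd : Nat.card (altEnd d) = 2 ^ (Module.finrank (ZMod 2) (StdSpace d)).choose 2 := by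
  let b := Module.finBasis (ZMod 2) (StdSpace d)
  obtain ⟨c, hc⟩ := exists_dual_basis b
  have hbij : Function.Bijective (fun X : altEnd d =>
      fun p : {p : Fin (Module.finrank (ZMod 2) (StdSpace d)) × Fin _ // p.1 < p.2} =>
        stdForm d (X.1 (b p.1.1)) (b p.1.2)) := by
    constructor
    · intro X Y h
      exact Subtype.ext (altEnd_ext b X.2 Y.2 fun i j hij => congrFun h ⟨(i, j), hij⟩)
    · intro f
      refine ⟨⟨_, sum_wedgeEnd_mem (altEnd d) c (fun _ _ => wedgeEnd_mem_altEnd _ _) f⟩, ?_⟩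
      funext p
      exact stdForm_sum_wedgeEnd b hc f p.1.1 p.1.2 p.2
  rw [Nat.card_eq_of_bijective _ hbij, Nat.card_fun, Nat.card_eq_fintype_card (α := {_p // _}),
    card_pairs_lt, Nat.card_zmod]

end Endomorphisms

/-! ### Permutation-stable groups of endomorphisms -/

section PermStable

variable {d : ℕ}

/-- The conjugate of an endomorphism by a permutation. -/
def conjPerm (σ : Equiv.Perm (Fin d)) (X : Module.End (ZMod 2) (StdSpace d)) :
    Module.End (ZMod 2) (StdSpace d) := permStd σ * X * permStd σ⁻¹

theorem conjPerm_apply (σ : Equiv.Perm (Fin d)) (X : Module.End (ZMod 2) (StdSpace d))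
    (x : StdSpace d) : conjPerm σ X x = permStd σ (X (permStd σ⁻¹ x)) := rfl

theorem conjPerm_add (σ : Equiv.Perm (Fin d)) (X Y : Module.End (ZMod 2) (StdSpace d)) :
    conjPerm σ (X + Y) = conjPerm σ X + conjPerm σ Y := by
  unfold conjPerm
  rw [mul_add, add_mul]

theorem conjPerm_sqEnd (σ : Equiv.Perm (Fin d)) (x : StdSpace d) :
    conjPerm σ (sqEnd x) = sqEnd (permStd σ x) := by
  refine LinearMap.ext fun y => ?_
  rw [conjPerm_apply, sqEnd_apply, sqEnd_apply, map_smul, stdForm_permStd_left, inv_inv]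

theorem conjPerm_wedgeEnd (σ : Equiv.Perm (Fin d)) (x y : StdSpace d) :
    conjPerm σ (wedgeEnd x y) = wedgeEnd (permStd σ x) (permStd σ y) := by
  refine LinearMap.ext fun z => ?_
  rw [conjPerm_apply, wedgeEnd_apply, wedgeEnd_apply, map_add, map_smul, map_smul,
    stdForm_permStd_left, stdForm_permStd_left, inv_inv]

/-- `X + τ X τ` for a self-adjoint `X` and a transposition `τ`. -/
theorem add_conjPerm_swap {X : Module.End (ZMod 2) (StdSpace d)} (hX : X ∈ symEnd d)
    (i j : Fin d) :
    X + conjPerm (Equiv.swap i j) X = wedgeEnd (pairVec i j) (X (pairVec i j)) +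
      stdForm d (X (pairVec i j)) (pairVec i j) • sqEnd (pairVec i j) := by
  refine LinearMap.ext fun y => ?_
  rw [LinearMap.add_apply, conjPerm_apply, Equiv.swap_inv, permStd_swap, permStd_swap]
  simp only [LinearMap.add_apply, LinearMap.smul_apply, wedgeEnd_apply, sqEnd_apply, map_add,
    map_smul, smul_eq_mul, add_smul, mul_smul]
  rw [hX y]
  refine Eq.trans ?_ (zero_add _)
  rw [← add_self_std (X y)]
  module

/-- Stability under conjugation by permutations. -/
def PermStable (M : AddSubgroup (Module.End (ZMod 2) (StdSpace d))) : Prop :=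
  ∀ σ, ∀ X ∈ M, conjPerm σ X ∈ M

variable {M : AddSubgroup (Module.End (ZMod 2) (StdSpace d))}

theorem PermStable.sqEnd_pairVec (hM : PermStable M) {i j : Fin d} (hij : i ≠ j)
    (h : sqEnd (pairVec i j) ∈ M) (k l : Fin d) : sqEnd (pairVec k l) ∈ M := by
  rcases eq_or_ne k l with rfl | hkl
  · rw [pairVec_self, sqEnd_zero]; exact M.zero_mem
  · obtain ⟨σ, hσ⟩ := Equiv.Perm.exists_extending_pair ![i, j] ![k, l]
      (by simp [Function.Injective, Fin.forall_fin_two, hij, hij.symm])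
      (by simp [Function.Injective, Fin.forall_fin_two, hkl, hkl.symm])
    have := hM σ _ h
    rw [conjPerm_sqEnd, permStd_pairVec] at this
    have h0 : σ i = k := hσ 0
    have h1 : σ j = l := hσ 1
    rwa [h0, h1] at this

theorem injective_vec_four {α : Type*} {i j k l : α} (hij : i ≠ j) (hik : i ≠ k) (hil : i ≠ l)
    (hjk : j ≠ k) (hjl : j ≠ l) (hkl : k ≠ l) : Function.Injective ![i, j, k, l] := by
  simp [Function.Injective, Fin.forall_fin_succ, hij, hik, hil, hjk, hjl, hkl, hij.symm, hik.symm,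
    hil.symm, hjk.symm, hjl.symm, hkl.symm]

theorem wedgeEnd_mem_of_pairVec (a : Fin d)
    (h : ∀ k l, wedgeEnd (pairVec a k) (pairVec a l) ∈ M) (x y : StdSpace d) :
    wedgeEnd x y ∈ M := by
  have h1 : ∀ k y, wedgeEnd (pairVec a k) y ∈ M := fun k y =>
    mem_of_pairVec_mem (M.comap (AddMonoidHom.mk' (wedgeEnd (pairVec a k))
      (wedgeEnd_add_right _))) a (h k) y
  exact mem_of_pairVec_mem (M.comap (AddMonoidHom.mk' (fun x => wedgeEnd x y)
      (fun _ _ => wedgeEnd_add_left _ _ _))) a (fun k => h1 k y) x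

/-- A permutation-stable group containing `v_{ij} ⊗ v_{ij}` contains all self-adjoint
endomorphisms. -/
theorem PermStable.symEnd_le (hM : PermStable M) {i j : Fin d} (hij : i ≠ j)
    (h : sqEnd (pairVec i j) ∈ M) : symEnd d ≤ M := by
  have hsq := hM.sqEnd_pairVec hij h
  have hw : ∀ x y, wedgeEnd x y ∈ M := wedgeEnd_mem_of_pairVec i fun k l => by
    have h1 := sqEnd_add (pairVec i k) (pairVec i l)
    rw [pairVec_add'] at h1
    have h2 := M.sub_mem (hsq k l) (M.add_mem (hsq i k) (hsq i l))
    rwa [h1, add_sub_cancel_left] at h2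
  have hsq' : ∀ x, sqEnd x ∈ M := by
    -- The map x ↦ x ⊗ x is additive up to wedges, which already lie in M, so the x with x ⊗ x in M
    -- form a subgroup.
    let N : AddSubgroup (StdSpace d) :=
      { carrier := {x | sqEnd x ∈ M}
        add_mem' := by
          intro x y hx hy
          change sqEnd _ ∈ M
          rw [sqEnd_add]
          exact M.add_mem (M.add_mem hx hy) (hw _ _)
        zero_mem' := by
          change sqEnd _ ∈ M
          rw [sqEnd_zero]
          exact M.zero_mem
        neg_mem' := by intro x hx; rwa [neg_std] }
    exact mem_of_pairVec_mem N i (hsq i)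
  intro X hX
  obtain ⟨w, hw'⟩ := exists_diag hX
  have h1 := altEnd_le_of_wedgeEnd_mem M hw (add_sqEnd_mem_altEnd hw')
  simpa using M.sub_mem h1 (hsq' w)

/-- If `M` contains all alternating endomorphisms and one that is not alternating, then it
contains all self-adjoint endomorphisms. -/
theorem PermStable.symEnd_le_of_not_altEnd (hM : PermStable M) (hle : M ≤ symEnd d)
    (halt : altEnd d ≤ M) (hnot : ¬ M ≤ altEnd d) : symEnd d ≤ M := by
  obtain ⟨X, hXM, hX⟩ := SetLike.not_le_iff_exists.1 hnot
  obtain ⟨w, hw⟩ := exists_diag (hle hXM)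
  have hsq : sqEnd w ∈ M := by
    have := M.sub_mem (halt (add_sqEnd_mem_altEnd hw)) hXM
    rwa [add_sub_cancel_left] at this
  have hw0 : w ≠ 0 := by
    rintro rfl
    exact hX fun x => by rw [hw, map_zero]
  have : ∃ k l, stdForm d w (pairVec k l) ≠ 0 := by
    by_contra! hcon
    exact hw0 (eq_zero_of_stdForm_pairVec w hcon)
  obtain ⟨k, l, hkl⟩ := this
  have hkl' : k ≠ l := by
    rintro rfl
    rw [pairVec_self, map_zero] at hkl
    exact hkl rfl
  have h1 : stdForm d w (pairVec k l) = 1 := (zmod_two_cases _).resolve_left hkl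
  refine hM.symEnd_le hkl' ?_
  -- The transposition moves w to w + v_kl. Expanding (w + v_kl) ⊗ (w + v_kl) isolates v_kl ⊗ v_kl
  -- modulo a wedge.
  have h2 := hM (Equiv.swap k l) _ hsq
  rw [conjPerm_sqEnd, permStd_swap, h1, one_smul, sqEnd_add] at h2
  have h3 := M.sub_mem h2 (M.add_mem hsq (halt (wedgeEnd_mem_altEnd w (pairVec k l))))
  convert h3 using 1
  abel

/-- `M` contains all the endomorphisms `v_{ij} ∧ v_{kl}` for disjoint pairs. -/
def ContainsDisjoint (M : AddSubgroup (Module.End (ZMod 2) (StdSpace d))) : Prop :=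
  ∀ i j k l : Fin d, i ≠ k → i ≠ l → j ≠ k → j ≠ l → wedgeEnd (pairVec i j) (pairVec k l) ∈ M

theorem PermStable.containsDisjoint (hM : PermStable M) {i j k l : Fin d} (hij : i ≠ j)
    (hkl : k ≠ l) (hik : i ≠ k) (hil : i ≠ l) (hjk : j ≠ k) (hjl : j ≠ l)
    (h : wedgeEnd (pairVec i j) (pairVec k l) ∈ M) : ContainsDisjoint M := by
  intro i' j' k' l' hik' hil' hjk' hjl'
  rcases eq_or_ne i' j' with rfl | hij'
  · rw [pairVec_self, wedgeEnd_zero_left]; exact M.zero_mem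
  rcases eq_or_ne k' l' with rfl | hkl'
  · rw [pairVec_self, wedgeEnd_zero_right]; exact M.zero_mem
  obtain ⟨σ, hσ⟩ := Equiv.Perm.exists_extending_pair ![i, j, k, l] ![i', j', k', l']
    (injective_vec_four hij hik hil hjk hjl hkl) (injective_vec_four hij' hik' hil' hjk' hjl' hkl')
  have := hM σ _ h
  rw [conjPerm_wedgeEnd, permStd_pairVec, permStd_pairVec] at this
  have h0 : σ i = i' := hσ 0
  have h1 : σ j = j' := hσ 1
  have h2 : σ k = k' := hσ 2
  have h3 : σ l = l' := hσ 3
  rwa [h0, h1, h2, h3] at this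

/-- Modulo the span of the `v_{ij} ∧ v_{kl}` for disjoint pairs, `x ∧ y` depends on `⟨x, y⟩`
only. -/
theorem ContainsDisjoint.wedgeEnd_add_mem (hU : ContainsDisjoint M) {a b c : Fin d} (hab : a ≠ b)
    (hac : a ≠ c) (hbc : b ≠ c) (x y : StdSpace d) :
    wedgeEnd x y + stdForm d x y • wedgeEnd (pairVec a b) (pairVec a c) ∈ M := by
  set ω := wedgeEnd (pairVec a b) (pairVec a c) with hω
  have key : ∀ k l, wedgeEnd (pairVec a k) (pairVec a l) +
      stdForm d (pairVec a k) (pairVec a l) • ω ∈ M := by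
    intro k l
    rcases eq_or_ne k l with rfl | hkl
    · rw [wedgeEnd_self, stdForm_self, zero_smul, add_zero]; exact M.zero_mem
    rcases eq_or_ne a k with rfl | hak
    · rw [pairVec_self, wedgeEnd_zero_left, map_zero, LinearMap.zero_apply, zero_smul, add_zero]
      exact M.zero_mem
    rcases eq_or_ne a l with rfl | hal
    · rw [pairVec_self, wedgeEnd_zero_right, map_zero, zero_smul, add_zero]
      exact M.zero_mem
    rw [stdForm_pairVec_of_common hak hal hkl, one_smul]
    -- The sum v_ab ∧ v_am + v_ab ∧ v_an equals v_ab ∧ v_mn, a wedge of disjoint pairs. So one index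
    -- of a wedge with a common vertex can be changed at a time.
    have step : ∀ m n, a ≠ m → a ≠ n → b ≠ m → b ≠ n → wedgeEnd (pairVec a b) (pairVec a m) +
        wedgeEnd (pairVec a b) (pairVec a n) ∈ M := by
      intro m n ham han hbm hbn
      rw [← wedgeEnd_add_right, pairVec_add']
      exact hU _ _ _ _ ham han hbm hbn
    rcases eq_or_ne l b with rfl | hlb
    · rw [wedgeEnd_comm]
      exact step _ _ hak hac hkl.symm hbc
    · have h1 : wedgeEnd (pairVec a k) (pairVec a l) + wedgeEnd (pairVec a b) (pairVec a l) ∈ M := by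
        rw [← wedgeEnd_add_left, pairVec_add', wedgeEnd_comm]
        exact hU _ _ _ _ hak hab hkl.symm hlb
      have h2 := M.add_mem h1 (step l c hal hac hlb.symm hbc)
      rwa [add_assoc, ← add_assoc (wedgeEnd (pairVec a b) (pairVec a l)), add_self_end,
        zero_add] at h2
  have h1 : ∀ k y, wedgeEnd (pairVec a k) y + stdForm d (pairVec a k) y • ω ∈ M := fun k y =>
    mem_of_pairVec_mem (M.comap (AddMonoidHom.mk' (fun y => wedgeEnd (pairVec a k) y +
      stdForm d (pairVec a k) y • ω) (fun y z => by
        rw [wedgeEnd_add_right, map_add, add_smul]; abel))) a (key k) y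
  exact mem_of_pairVec_mem (M.comap (AddMonoidHom.mk' (fun x => wedgeEnd x y +
      stdForm d x y • ω) (fun x z => by
        rw [wedgeEnd_add_left, map_add, LinearMap.add_apply, add_smul]; abel))) a
      (fun k => h1 k y) x

theorem ContainsDisjoint.altEnd_le (hU : ContainsDisjoint M) {a b c : Fin d} (hab : a ≠ b)
    (hac : a ≠ c) (hbc : b ≠ c) (h : wedgeEnd (pairVec a b) (pairVec a c) ∈ M) :
    altEnd d ≤ M := by
  refine altEnd_le_of_wedgeEnd_mem M fun x y => ?_
  have h1 := M.sub_mem (hU.wedgeEnd_add_mem hab hac hbc x y)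
    (M.zmodTwo_smul_mem h (stdForm d x y))
  rwa [add_sub_cancel_right] at h1

end PermStable

/-! ### Criteria for a permutation-stable group to contain all alternating endomorphisms -/

section PermStable

variable {d : ℕ} {M : AddSubgroup (Module.End (ZMod 2) (StdSpace d))}

theorem exists_fin_notMem (s : Finset (Fin d)) (h : s.card < d) : ∃ k, k ∉ s := by
  by_contra! hcon
  have : s = Finset.univ := Finset.eq_univ_of_forall hcon
  rw [this, Finset.card_univ, Fintype.card_fin] at h
  exact lt_irrefl _ h

theorem exists_fin_ne_two (hd : 5 ≤ d) (i j : Fin d) : ∃ k, i ≠ k ∧ j ≠ k := by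
  obtain ⟨k, hk⟩ := exists_fin_notMem {i, j} (lt_of_le_of_lt Finset.card_le_two (by omega))
  simp only [Finset.mem_insert, Finset.mem_singleton, not_or] at hk
  exact ⟨k, Ne.symm hk.1, Ne.symm hk.2⟩

theorem exists_fin_ne_three (hd : 5 ≤ d) (i j k : Fin d) : ∃ l, i ≠ l ∧ j ≠ l ∧ k ≠ l := by
  obtain ⟨l, hl⟩ := exists_fin_notMem {i, j, k} (lt_of_le_of_lt Finset.card_le_three (by omega))
  simp only [Finset.mem_insert, Finset.mem_singleton, not_or] at hl
  exact ⟨l, Ne.symm hl.1, Ne.symm hl.2.1, Ne.symm hl.2.2⟩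

theorem exists_fin_ne_four (hd : 5 ≤ d) (i j k l : Fin d) :
    ∃ m, i ≠ m ∧ j ≠ m ∧ k ≠ m ∧ l ≠ m := by
  obtain ⟨m, hm⟩ := exists_fin_notMem {i, j, k, l} (lt_of_le_of_lt Finset.card_le_four (by omega))
  simp only [Finset.mem_insert, Finset.mem_singleton, not_or] at hm
  exact ⟨m, Ne.symm hm.1, Ne.symm hm.2.1, Ne.symm hm.2.2.1, Ne.symm hm.2.2.2⟩

/-- Let ω be a wedge of two pairs with one common index. Modulo disjoint wedges the given element is
cω + (1 + c) v_ij ⊗ v_ij with c = ⟨z, v_ij⟩, so it is either ω or v_ij ⊗ v_ij, and each of these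
suffices. -/
theorem PermStable.altEnd_le_of_containsDisjoint (hd : 5 ≤ d) (hM : PermStable M)
    (hU : ContainsDisjoint M) {i j : Fin d} (hij : i ≠ j) (z : StdSpace d)
    (h : wedgeEnd (pairVec i j) z + (1 + stdForm d z (pairVec i j)) • sqEnd (pairVec i j) ∈ M) :
    altEnd d ≤ M := by
  obtain ⟨k, hik, hjk⟩ := exists_fin_ne_two hd i j
  have hP := hU.wedgeEnd_add_mem hij hik hjk (pairVec i j) z
  rw [stdForm_comm] at hP
  rcases zmod_two_cases (stdForm d z (pairVec i j)) with h0 | h0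
  · rw [h0, add_zero, one_smul] at h
    rw [h0, zero_smul, add_zero] at hP
    have h1 := M.sub_mem h hP
    rw [add_sub_cancel_left] at h1
    exact altEnd_le_symEnd.trans (hM.symEnd_le hij h1)
  · rw [h0, show (1 + 1 : ZMod 2) = 0 from rfl, zero_smul, add_zero] at h
    rw [h0, one_smul] at hP
    have h1 := M.sub_mem hP h
    rw [add_sub_cancel_left] at h1
    exact hU.altEnd_le hij hik hjk h1

/-- Here z pairs like e_i. Adding the conjugate by (j k), which fixes z, turns v_ij into v_jk.
Adding then the conjugate by (i l), which moves z by v_il and fixes v_jk, leaves v_jk ∧ v_il. -/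
theorem PermStable.containsDisjoint_of_wedgeEnd (hd : 5 ≤ d) (hM : PermStable M)
    {i j : Fin d} (hij : i ≠ j) (z : StdSpace d) (h : wedgeEnd (pairVec i j) z ∈ M)
    (h0 : ∀ k l, i ≠ k → i ≠ l → stdForm d z (pairVec k l) = 0)
    (h1 : ∀ k, i ≠ k → stdForm d z (pairVec i k) = 1) : ContainsDisjoint M := by
  obtain ⟨k, hik, hjk⟩ := exists_fin_ne_two hd i j
  obtain ⟨l, hil, hjl, hkl⟩ := exists_fin_ne_three hd i j k
  have e1 : wedgeEnd (pairVec j k) z ∈ M := by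
    have h2 := M.add_mem h (hM (Equiv.swap j k) _ h)
    rwa [conjPerm_wedgeEnd, permStd_pairVec, permStd_swap _ _ z, h0 j k hij hik, zero_smul,
      add_zero, Equiv.swap_apply_of_ne_of_ne hij hik, Equiv.swap_apply_left,
      ← wedgeEnd_add_left, pairVec_add'] at h2
  have h2 := M.add_mem e1 (hM (Equiv.swap i l) _ e1)
  rw [conjPerm_wedgeEnd, permStd_pairVec, permStd_swap _ _ z, h1 l hil, one_smul,
    Equiv.swap_apply_of_ne_of_ne hij.symm hjl, Equiv.swap_apply_of_ne_of_ne hik.symm hkl,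
    ← wedgeEnd_add_right, ← add_assoc, add_self_std, zero_add] at h2
  exact hM.containsDisjoint hjk hil hij.symm hjl hik.symm hkl h2

/-- The symbol of the square of a lift of a transposition generates a group containing all
alternating endomorphisms. -/
theorem PermStable.altEnd_le_of_square (hd : 5 ≤ d) (hM : PermStable M) {i j : Fin d}
    (hij : i ≠ j) (z : StdSpace d)
    (h : wedgeEnd (pairVec i j) z + (1 + stdForm d z (pairVec i j)) • sqEnd (pairVec i j) ∈ M) :
    altEnd d ≤ M := by
  by_cases hex : ∃ k l, i ≠ k ∧ j ≠ k ∧ i ≠ l ∧ j ≠ l ∧ stdForm d z (pairVec k l) = 1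
  · obtain ⟨k, l, hik, hjk, hil, hjl, hz⟩ := hex
    have hkl : k ≠ l := by
      rintro rfl
      rw [pairVec_self, map_zero] at hz
      exact zero_ne_one hz
    -- The transposition (k l) fixes v_ij and moves z to z + v_kl, so the sum with the conjugate is
    -- v_ij ∧ v_kl.
    have h1 := M.add_mem h (hM (Equiv.swap k l) _ h)
    have hv : permStd (Equiv.swap k l) (pairVec i j) = pairVec i j := by
      rw [permStd_pairVec, Equiv.swap_apply_of_ne_of_ne hik hil,
        Equiv.swap_apply_of_ne_of_ne hjk hjl]
    have hsm : ∀ c : ZMod 2, conjPerm (Equiv.swap k l) (c • sqEnd (pairVec i j))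
        = c • sqEnd (pairVec i j) := by
      intro c
      rcases zmod_two_cases c with rfl | rfl
      · simp [conjPerm]
      · rw [one_smul, conjPerm_sqEnd, hv]
    rw [conjPerm_add, hsm, conjPerm_wedgeEnd, hv, permStd_swap, hz, one_smul, wedgeEnd_add_right]
      at h1
    have h2 : wedgeEnd (pairVec i j) (pairVec k l) ∈ M := by
      convert h1 using 1
      rw [← sub_eq_zero, ← neg_end (_ - _), neg_sub, sub_eq_zero]
      have e1 := add_self_end (wedgeEnd (pairVec i j) z)
      have e2 := add_self_end ((1 + stdForm d z (pairVec i j)) • sqEnd (pairVec i j))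
      generalize (1 + stdForm d z (pairVec i j)) • sqEnd (pairVec i j) = Y at e2 ⊢
      rw [show ∀ a b c : Module.End (ZMod 2) (StdSpace d), a + b + (a + c + b) = (a + a) + (b + b) + c
        from fun a b c => by abel, e1, e2, zero_add, zero_add]
    exact hM.altEnd_le_of_containsDisjoint hd
      (hM.containsDisjoint hij hkl hik hil hjk hjl h2) hij z h
  -- Now z is constant off {i, j}. Only z modulo v_ij matters, and one may assume ⟨z, v_mj⟩ = 0.
  -- Then either z = 0, which leaves v_ij ⊗ v_ij, or z pairs like e_i.
  · have hz : ∀ k l, i ≠ k → j ≠ k → i ≠ l → j ≠ l → stdForm d z (pairVec k l) = 0 := by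
      intro k l hik hjk hil hjl
      exact (zmod_two_cases _).resolve_right fun h1 => hex ⟨k, l, hik, hjk, hil, hjl, h1⟩
    obtain ⟨m, him, hjm⟩ := exists_fin_ne_two hd i j
    have hadd : ∀ z k l n, stdForm d z (pairVec k l) = stdForm d z (pairVec n k) +
        stdForm d z (pairVec n l) := by
      intro z k l n
      rw [← map_add, pairVec_add']
    -- the values on pairs meeting `{i, j}`
    have main : ∀ z : StdSpace d, (∀ k l, i ≠ k → j ≠ k → i ≠ l → j ≠ l →
        stdForm d z (pairVec k l) = 0) → stdForm d z (pairVec m j) = 0 →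
        (stdForm d z (pairVec m i) = 0 → z = 0) ∧ (stdForm d z (pairVec m i) = 1 →
          (∀ k l, i ≠ k → i ≠ l → stdForm d z (pairVec k l) = 0) ∧
          (∀ k, i ≠ k → stdForm d z (pairVec i k) = 1)) := by
      intro z hz hj
      have hm0 : ∀ k, i ≠ k → stdForm d z (pairVec m k) = 0 := by
        intro k hik
        rcases eq_or_ne j k with rfl | hjk
        · exact hj
        · exact hz _ _ him hjm hik hjk
      refine ⟨fun hi => ?_, fun hi => ⟨fun k l hk hl => ?_, fun k hk => ?_⟩⟩
      · have hm0' : ∀ k, stdForm d z (pairVec m k) = 0 := by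
          intro k
          rcases eq_or_ne i k with rfl | hik
          · exact hi
          · exact hm0 k hik
        exact eq_zero_of_stdForm_pairVec z fun k l => by rw [hadd z k l m, hm0', hm0', add_zero]
      · rw [hadd z k l m, hm0 k hk, hm0 l hl, add_zero]
      · rw [hadd z i k m, hm0 k hk, hi, add_zero]
    -- replacing `z` by `z + v_{ij}` does not change the hypotheses
    obtain ⟨z', hz', hj', hw, hf⟩ : ∃ z', (∀ k l, i ≠ k → j ≠ k → i ≠ l → j ≠ l →
        stdForm d z' (pairVec k l) = 0) ∧ stdForm d z' (pairVec m j) = 0 ∧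
        wedgeEnd (pairVec i j) z = wedgeEnd (pairVec i j) z' ∧
        stdForm d z (pairVec i j) = stdForm d z' (pairVec i j) := by
      rcases zmod_two_cases (stdForm d z (pairVec m j)) with h0 | h0
      · exact ⟨z, hz, h0, rfl, rfl⟩
      · refine ⟨z + pairVec i j, fun k l hik hjk hil hjl => ?_, ?_, ?_, ?_⟩
        · rw [map_add, LinearMap.add_apply, hz k l hik hjk hil hjl,
            stdForm_pairVec_of_disjoint hik hil hjk hjl, add_zero]
        · rw [map_add, LinearMap.add_apply, h0, pairVec_comm i j, pairVec_comm m j,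
            stdForm_pairVec_of_common hij.symm hjm him]
          rfl
        · rw [wedgeEnd_add_right, wedgeEnd_self, add_zero]
        · rw [map_add, LinearMap.add_apply, stdForm_self, add_zero]
    rw [hw, hf] at h
    obtain ⟨hA, hB⟩ := main z' hz' hj'
    rcases zmod_two_cases (stdForm d z' (pairVec m i)) with hi | hi
    · rw [hA hi, wedgeEnd_zero_right, map_zero, LinearMap.zero_apply, zero_add, add_zero,
        one_smul] at h
      exact altEnd_le_symEnd.trans (hM.symEnd_le hij h)
    · obtain ⟨h0, h1⟩ := hB hi
      have h2 := h
      rw [h1 j hij, show (1 + 1 : ZMod 2) = 0 from rfl, zero_smul, add_zero] at h2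
      exact hM.altEnd_le_of_containsDisjoint hd
        (hM.containsDisjoint_of_wedgeEnd hd hij z' h2 h0 h1) hij z' h

/-- The symbol of a commutator of lifts of two disjoint transpositions, together with the
`v_{ij} ∧ v_{kl}` for disjoint pairs, generates a group containing all alternating
endomorphisms. -/
theorem PermStable.altEnd_le_of_commutator (hd : 5 ≤ d) (hM : PermStable M)
    (hU : ContainsDisjoint M) {i j k l : Fin d} (hij : i ≠ j) (hik : i ≠ k) (hil : i ≠ l)
    (hjk : j ≠ k) (hjl : j ≠ l) (hkl : k ≠ l) {w w' z z' : StdSpace d}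
    (hw : stdForm d w w' = 1)
    (h : wedgeEnd w w' + (wedgeEnd (pairVec i j) z + stdForm d z (pairVec i j) •
      sqEnd (pairVec i j)) + (wedgeEnd (pairVec k l) z' + stdForm d z' (pairVec k l) •
      sqEnd (pairVec k l)) ∈ M) : altEnd d ≤ M := by
  obtain ⟨m, him, hjm, hkm, hlm⟩ := exists_fin_ne_four hd i j k l
  set ω := wedgeEnd (pairVec i j) (pairVec i k) with hω
  have hP := fun x y => hU.wedgeEnd_add_mem hij hik hjk x y
  have hωω := add_self_end ω
  have e1 := hP w w'
  rw [hw, one_smul] at e1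
  have e2 := hP (pairVec i j) z
  have e3 := hP (pairVec k l) z'
  rw [stdForm_comm] at e2 e3
  suffices hω' : ω ∈ M from hU.altEnd_le hij hik hjk hω'
  have hsq : ∀ {a b : Fin d}, a ≠ b → sqEnd (pairVec a b) ∈ M → ω ∈ M := fun hab hs =>
    altEnd_le_symEnd.trans (hM.symEnd_le hab hs) (wedgeEnd_mem_altEnd _ _)
  -- Modulo disjoint wedges the given element is ω + c(ω + v_ij ⊗ v_ij) + c'(ω + v_kl ⊗ v_kl), where
  -- c and c' are the pairings ⟨z, v_ij⟩ and ⟨z', v_kl⟩.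
  have h1 := M.sub_mem h (M.add_mem (M.add_mem e1 e2) e3)
  rcases zmod_two_cases (stdForm d z (pairVec i j)) with hz | hz <;>
    rcases zmod_two_cases (stdForm d z' (pairVec k l)) with hz' | hz' <;>
    simp only [hz, hz', zero_smul, one_smul, add_zero] at h1
  · have : ω = -(wedgeEnd w w' + wedgeEnd (pairVec i j) z + wedgeEnd (pairVec k l) z' -
      (wedgeEnd w w' + wedgeEnd (pairVec i j) (pairVec i k) + wedgeEnd (pairVec i j) z +
      wedgeEnd (pairVec k l) z')) := by rw [← hω]; abel
    rw [this]
    exact M.neg_mem h1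
  · refine hsq hkl ?_
    convert h1 using 1
    rw [← hω, show ∀ a b c s o : Module.End (ZMod 2) (StdSpace d),
      a + b + (c + s) - (a + o + b + (c + o)) = s - (o + o) from fun a b c s o => by abel, hωω,
      sub_zero]
  · refine hsq hij ?_
    convert h1 using 1
    rw [← hω, show ∀ a b c s o : Module.End (ZMod 2) (StdSpace d),
      a + (b + s) + c - (a + o + (b + o) + c) = s - (o + o) from fun a b c s o => by abel, hωω,
      sub_zero]
  -- In the case c = c' = 1, adding the conjugate by (l m) cancels v_ij ⊗ v_ij and leaves v_kl ⊗
  -- v_kl + v_km ⊗ v_km, which is v_lm ⊗ v_lm + ω modulo disjoint wedges. So M contains every v_ab ⊗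
  -- v_ab + ω, and comparing two of these with `h2` isolates ω.
  · have h2 : sqEnd (pairVec i j) + sqEnd (pairVec k l) + ω ∈ M := by
      convert h1 using 1
      rw [← hω, show ∀ a b c s t o : Module.End (ZMod 2) (StdSpace d),
        a + (b + s) + (c + t) - (a + o + (b + o) + (c + o)) = s + t - (o + o) - o from
        fun a b c s t o => by abel, hωω, sub_zero, sub_eq_add_neg, neg_end]
    have hconj : ∀ σ, conjPerm σ ω + ω ∈ M := by
      intro σ
      rw [hω, conjPerm_wedgeEnd]
      have := hP (permStd σ (pairVec i j)) (permStd σ (pairVec i k))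
      rwa [stdForm_permStd, stdForm_pairVec_of_common hij hik hjk, one_smul] at this
    have h3 : sqEnd (pairVec l m) + ω ∈ M := by
      have h4 := hM (Equiv.swap l m) _ h2
      rw [conjPerm_add, conjPerm_add, conjPerm_sqEnd, conjPerm_sqEnd, permStd_pairVec,
        permStd_pairVec, Equiv.swap_apply_of_ne_of_ne hil him,
        Equiv.swap_apply_of_ne_of_ne hjl hjm, Equiv.swap_apply_of_ne_of_ne hkl hkm,
        Equiv.swap_apply_left] at h4
      have h5 := hP (pairVec k l) (pairVec k m)
      rw [stdForm_pairVec_of_common hkl hkm hlm, one_smul] at h5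
      have h6 := M.add_mem (M.sub_mem (M.add_mem h4 h2) (hconj (Equiv.swap l m))) h5
      rw [← pairVec_add' k l m, sqEnd_add]
      convert h6 using 1
      have := add_self_end (sqEnd (pairVec i j))
      rw [← hω, show ∀ a s t w o c : Module.End (ZMod 2) (StdSpace d),
        a + s + c + (a + t + o) - (c + o) + (w + o) = (a + a) + (t + s + w + o) from
        fun a s t w o c => by abel, this, zero_add]
    have h4 : ∀ a b, a ≠ b → sqEnd (pairVec a b) + ω ∈ M := by
      intro a b hab
      obtain ⟨σ, hσ⟩ := Equiv.Perm.exists_extending_pair ![l, m] ![a, b]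
        (by simp [Function.Injective, Fin.forall_fin_two, hlm, hlm.symm])
        (by simp [Function.Injective, Fin.forall_fin_two, hab, hab.symm])
      have h5 := hM σ _ h3
      have h0 : σ l = a := hσ 0
      have h1 : σ m = b := hσ 1
      rw [conjPerm_add, conjPerm_sqEnd, permStd_pairVec, h0, h1] at h5
      have h6 := M.sub_mem h5 (hconj σ)
      rw [add_comm (conjPerm σ ω) ω, add_sub_add_right_eq_sub, sub_eq_add_neg, neg_end] at h6
      exact h6
    have h5 := M.sub_mem (M.add_mem (h4 i j hij) (h4 k l hkl)) h2
    rwa [show ∀ s t o : Module.End (ZMod 2) (StdSpace d), s + o + (t + o) - (s + t + o) = o from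
      fun s t o => by abel] at h5

end PermStable

/-! ### Cohomology of the standard representation -/

section Cohomology

variable {d : ℕ}

theorem stdForm_pairVec_eq_add (z : StdSpace d) (k l n : Fin d) :
    stdForm d z (pairVec k l) = stdForm d z (pairVec n k) + stdForm d z (pairVec n l) := by
  rw [← map_add, pairVec_add']

theorem eq_zero_of_stdForm_pairVec_left (x : StdSpace d) (m : Fin d)
    (h : ∀ k, stdForm d x (pairVec m k) = 0) : x = 0 :=
  eq_zero_of_stdForm_pairVec x fun k l => by rw [stdForm_pairVec_eq_add x k l m, h, h, add_zero]

theorem pairVec_ne_zero (hd : 5 ≤ d) {i j : Fin d} (hij : i ≠ j) : pairVec i j ≠ 0 := by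
  obtain ⟨k, hik, hjk⟩ := exists_fin_ne_two hd i j
  intro h
  have := stdForm_pairVec_of_common hij hik hjk
  rw [h, map_zero, LinearMap.zero_apply] at this
  exact zero_ne_one this

theorem stdForm_eq_zero_of_permStd_swap (hd : 5 ≤ d) {i j : Fin d} {x : StdSpace d}
    (h : permStd (Equiv.swap i j) x = x) : stdForm d x (pairVec i j) = 0 := by
  rcases eq_or_ne i j with rfl | hij
  · rw [pairVec_self, map_zero]
  · rw [permStd_swap, add_eq_left, smul_eq_zero] at h
    exact h.resolve_right (pairVec_ne_zero hd hij)

/-- A representative of z is constant off {i, j} and takes equal values at i and j. Only the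
difference between the two constants is free. -/
theorem eq_zero_or_eq_pairVec (hd : 5 ≤ d) {i j : Fin d} (hij : i ≠ j) {z : StdSpace d}
    (hz : ∀ k l, i ≠ k → j ≠ k → i ≠ l → j ≠ l → stdForm d z (pairVec k l) = 0)
    (h : stdForm d z (pairVec i j) = 0) : z = 0 ∨ z = pairVec i j := by
  obtain ⟨m, him, hjm⟩ := exists_fin_ne_two hd i j
  have main : ∀ z : StdSpace d, (∀ k l, i ≠ k → j ≠ k → i ≠ l → j ≠ l →
      stdForm d z (pairVec k l) = 0) → stdForm d z (pairVec i j) = 0 →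
      stdForm d z (pairVec m i) = 0 → z = 0 := by
    intro z hz hij hi
    refine eq_zero_of_stdForm_pairVec_left z m fun k => ?_
    rcases eq_or_ne i k with rfl | hik
    · exact hi
    rcases eq_or_ne j k with rfl | hjk
    · rw [stdForm_pairVec_eq_add z m j i, hij, pairVec_comm, hi, add_zero]
    · exact hz _ _ him hjm hik hjk
  rcases zmod_two_cases (stdForm d z (pairVec m i)) with h0 | h0
  · exact Or.inl (main z hz h h0)
  · refine Or.inr ?_
    rw [← neg_std (pairVec i j)]
    refine eq_neg_of_add_eq_zero_left (main _ (fun k l hik hjk hil hjl => ?_) ?_ ?_)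
    · rw [map_add, LinearMap.add_apply, hz k l hik hjk hil hjl,
        stdForm_pairVec_of_disjoint hik hil hjk hjl, add_zero]
    · rw [map_add, LinearMap.add_apply, h, stdForm_self, add_zero]
    · rw [map_add, LinearMap.add_apply, h0, pairVec_comm m i,
        stdForm_pairVec_of_common hij him hjm]
      rfl

/-- Every equivariant homomorphism from the alternating endomorphisms to the standard
representation, given by its graph `R`, vanishes. -/
theorem eq_zero_of_equivariant (hd : 5 ≤ d)
    (R : AddSubgroup (Module.End (ZMod 2) (StdSpace d) × StdSpace d))
    (hR : ∀ σ X y, (X, y) ∈ R → (conjPerm σ X, permStd σ y) ∈ R)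
    (hfun : ∀ y, (0, y) ∈ R → y = 0) (htot : ∀ X ∈ altEnd d, ∃ y, (X, y) ∈ R)
    {X : Module.End (ZMod 2) (StdSpace d)} (hX : X ∈ altEnd d) {y : StdSpace d}
    (hXy : (X, y) ∈ R) : y = 0 := by
  have huniq : ∀ X y y', (X, y) ∈ R → (X, y') ∈ R → y = y' := by
    intro X y y' h h'
    have := R.sub_mem h h'
    rw [Prod.mk_sub_mk, sub_self] at this
    exact sub_eq_zero.1 (hfun _ this)
  have key : ∀ i j k : Fin d, i ≠ j → i ≠ k → j ≠ k →
      (wedgeEnd (pairVec i j) (pairVec i k), (0 : StdSpace d)) ∈ R := by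
    intro i j k hij hik hjk
    obtain ⟨y, hy⟩ := htot _ (wedgeEnd_mem_altEnd (pairVec i j) (pairVec i k))
    suffices hy0 : y = 0 by rwa [hy0] at hy
    have hfix : ∀ σ, conjPerm σ (wedgeEnd (pairVec i j) (pairVec i k)) =
        wedgeEnd (pairVec i j) (pairVec i k) → permStd σ y = y := by
      intro σ hσ
      have := hR σ _ _ hy
      rw [hσ] at this
      exact huniq _ _ _ this hy
    have h1 : stdForm d y (pairVec i j) = 0 := by
      refine stdForm_eq_zero_of_permStd_swap hd (hfix _ ?_)
      rw [conjPerm_wedgeEnd, permStd_pairVec, permStd_pairVec, Equiv.swap_apply_left,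
        Equiv.swap_apply_right, Equiv.swap_apply_of_ne_of_ne hik.symm hjk.symm,
        ← pairVec_add' i j k, wedgeEnd_add_right, pairVec_comm j i, wedgeEnd_self, zero_add]
    have h2 : stdForm d y (pairVec i k) = 0 := by
      refine stdForm_eq_zero_of_permStd_swap hd (hfix _ ?_)
      rw [conjPerm_wedgeEnd, permStd_pairVec, permStd_pairVec, Equiv.swap_apply_left,
        Equiv.swap_apply_right, Equiv.swap_apply_of_ne_of_ne hij.symm hjk,
        ← pairVec_add' i k j, wedgeEnd_add_left, pairVec_comm k i, wedgeEnd_self, zero_add,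
        wedgeEnd_comm]
    refine eq_zero_of_stdForm_pairVec_left y i fun l => ?_
    rcases eq_or_ne j l with rfl | hjl
    · exact h1
    rcases eq_or_ne k l with rfl | hkl
    · exact h2
    rcases eq_or_ne i l with rfl | hil
    · rw [pairVec_self, map_zero]
    obtain ⟨m, him, hjm, hkm, hlm⟩ := exists_fin_ne_four hd i j k l
    -- The value y is fixed by (j k)-free moves within the triple, as just used; transporting it by
    -- transpositions with l gives values on the other three triples of {i, j, k, l}, all expressed
    -- through b = ⟨y, v_il⟩.
    have e1 := hR (Equiv.swap k l) _ _ hy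
    have e2 := hR (Equiv.swap j l) _ _ hy
    have e3 := hR (Equiv.swap i l) _ _ hy
    rw [conjPerm_wedgeEnd, permStd_pairVec, permStd_pairVec, permStd_swap] at e1 e2 e3
    rw [Equiv.swap_apply_of_ne_of_ne hik hil, Equiv.swap_apply_of_ne_of_ne hjk hjl,
      Equiv.swap_apply_left, stdForm_pairVec_eq_add y k l i, h2, zero_add] at e1
    rw [Equiv.swap_apply_of_ne_of_ne hij hil, Equiv.swap_apply_of_ne_of_ne hjk.symm hkl,
      Equiv.swap_apply_left, stdForm_pairVec_eq_add y j l i, h1, zero_add] at e2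
    rw [Equiv.swap_apply_of_ne_of_ne hij.symm hjl, Equiv.swap_apply_of_ne_of_ne hik.symm hkl,
      Equiv.swap_apply_left] at e3
    set b := stdForm d y (pairVec i l) with hb
    have hsum := R.add_mem (R.add_mem (R.add_mem hy e1) e2) e3
    rw [Prod.mk_add_mk, Prod.mk_add_mk, Prod.mk_add_mk] at hsum
    -- The wedges attached to the four faces of the tetrahedron i, j, k, l add up to zero, so their
    -- images do too. Pairing that sum of images with v_lm gives 3b = b.
    have hzero : wedgeEnd (pairVec i j) (pairVec i k) + wedgeEnd (pairVec i j) (pairVec i l) +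
        wedgeEnd (pairVec i l) (pairVec i k) + wedgeEnd (pairVec l j) (pairVec l k) = 0 := by
      rw [← pairVec_add' i l j, ← pairVec_add' i l k, wedgeEnd_add_left, wedgeEnd_add_right,
        wedgeEnd_add_right, wedgeEnd_self, zero_add, add_assoc, add_assoc,
        wedgeEnd_comm (pairVec i l) (pairVec i k)]
      rw [show ∀ p q r : Module.End (ZMod 2) (StdSpace d), p + (q + (r + (r + (q + p))))
        = (p + p) + (q + q) + (r + r) from fun p q r => by abel]
      simp only [add_self_end, add_zero]
    rw [hzero] at hsum
    have h0 := hfun _ hsum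
    have h3 : stdForm d (y + (y + b • pairVec k l) + (y + b • pairVec j l) + (y + b • pairVec i l))
        (pairVec l m) = b := by
      rw [pairVec_comm k, pairVec_comm j, pairVec_comm i]
      simp only [map_add, map_smul, LinearMap.add_apply, LinearMap.smul_apply, smul_eq_mul,
        stdForm_pairVec_of_common hkl.symm hlm hkm, stdForm_pairVec_of_common hjl.symm hlm hjm,
        stdForm_pairVec_of_common hil.symm hlm him]
      generalize stdForm d y (pairVec l m) = c
      generalize b = b'
      revert b' c; decide
    rw [← h3, h0, map_zero, LinearMap.zero_apply]
  let N : AddSubgroup (Module.End (ZMod 2) (StdSpace d)) :=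
    R.comap (AddMonoidHom.inl _ _)
  have hN : altEnd d ≤ N := by
    refine altEnd_le_of_wedgeEnd_mem N (wedgeEnd_mem_of_pairVec ⟨0, by omega⟩ fun k l => ?_)
    change (wedgeEnd _ _, (0 : StdSpace d)) ∈ R
    rcases eq_or_ne k l with rfl | hkl
    · rw [wedgeEnd_self]; exact R.zero_mem
    generalize (⟨0, by omega⟩ : Fin d) = a
    rcases eq_or_ne a k with rfl | hak
    · rw [pairVec_self, wedgeEnd_zero_left]; exact R.zero_mem
    rcases eq_or_ne a l with rfl | hal
    · rw [pairVec_self, wedgeEnd_zero_right]; exact R.zero_mem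
    exact key a k l hak hal hkl
  exact huniq _ _ _ hXy (hN hX)

/-- Adding the constant Σ c to every coordinate does not change pairings with the v_ak and, since d
is odd, brings the coordinate sum to zero. -/
theorem exists_stdForm_pairVec_eq (hd : Odd d) (a : Fin d) (c : Fin d → ZMod 2) (ha : c a = 0) :
    ∃ x : StdSpace d, ∀ k, stdForm d x (pairVec a k) = c k := by
  have hd' : (d : ZMod 2) = 1 := (ZMod.natCast_eq_one_iff_odd).2 hd
  refine ⟨(onesLine d).mkQ ⟨fun k => c k + ∑ l, c l, ?_⟩, fun k => ?_⟩
  · change ∑ k, (c k + ∑ l, c l) = 0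
    rw [Finset.sum_add_distrib, Finset.sum_const, Finset.card_univ, Fintype.card_fin,
      nsmul_eq_mul, hd', one_mul, CharTwo.add_self_eq_zero]
  · rw [stdForm_mk_pairVec]
    change c a + _ + (c k + _) = _
    rw [ha]
    linear_combination CharTwo.add_self_eq_zero (∑ l, c l)

/-- For odd `d` every crossed homomorphism from the symmetric group to the standard
representation is principal. -/
theorem exists_of_crossedHom (hd : 5 ≤ d) (hodd : Odd d) (ψ : Equiv.Perm (Fin d) → StdSpace d)
    (hψ : ∀ σ τ, ψ (σ * τ) = permStd τ⁻¹ (ψ σ) + ψ τ) :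
    ∃ x, ∀ σ, ψ σ = permStd σ⁻¹ x + x := by
  have hone : ψ 1 = 0 := by
    have := hψ 1 1
    rwa [one_mul, inv_one, permStd_one, left_eq_add] at this
  -- Commutation with a disjoint transposition (k l) gives ⟨ψ(i j), v_kl⟩ = 0, and (i j)² = 1 gives
  -- ⟨ψ(i j), v_ij⟩ = 0.
  have hswap : ∀ i j, i ≠ j → ψ (Equiv.swap i j) = 0 ∨ ψ (Equiv.swap i j) = pairVec i j := by
    intro i j hij
    refine eq_zero_or_eq_pairVec hd hij (fun k l hik hjk hil hjl => ?_) ?_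
    · rcases eq_or_ne k l with rfl | hkl
      · rw [pairVec_self, map_zero]
      have hc : Equiv.swap i j * Equiv.swap k l = Equiv.swap k l * Equiv.swap i j :=
        (Equiv.Perm.Disjoint.commute (Equiv.Perm.disjoint_swap_swap (by
          simp [hij, hik, hil, hjk, hjl, hkl]))).eq
      have h := congrArg ψ hc
      rw [hψ, hψ, Equiv.swap_inv, Equiv.swap_inv, permStd_swap, permStd_swap] at h
      obtain ⟨m, him, hjm, hkm, hlm⟩ := exists_fin_ne_four hd i j k l
      have h2 := congrArg (fun z => stdForm d z (pairVec k m)) h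
      simp only [map_add, map_smul, LinearMap.add_apply, LinearMap.smul_apply, smul_eq_mul,
        stdForm_pairVec_of_common hkl hkm hlm, stdForm_pairVec_of_disjoint hik him hjk hjm] at h2
      linear_combination h2
    · refine stdForm_eq_zero_of_permStd_swap hd ?_
      have h := hψ (Equiv.swap i j) (Equiv.swap i j)
      rw [Equiv.swap_mul_self, hone, Equiv.swap_inv] at h
      rw [eq_neg_of_add_eq_zero_left h.symm, neg_std]
  let a : Fin d := ⟨0, by omega⟩
  have hc : ∀ k, ∃ c : ZMod 2, ψ (Equiv.swap a k) = c • pairVec a k := by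
    intro k
    rcases eq_or_ne a k with hak | hak
    · exact ⟨0, by rw [← hak, Equiv.swap_self, zero_smul]; exact hone⟩
    rcases hswap a k hak with h | h
    · exact ⟨0, by rw [h, zero_smul]⟩
    · exact ⟨1, by rw [h, one_smul]⟩
  choose c hc using hc
  -- The transpositions (a k) generate S_d, so x only has to reproduce ψ on them. For k = a the
  -- scalar c is arbitrary and is replaced by 0.
  obtain ⟨x, hx⟩ := exists_stdForm_pairVec_eq hodd a (fun k => if k = a then 0 else c k)
    (if_pos rfl)
  refine ⟨x, ?_⟩
  have hstar : ∀ k, ψ (Equiv.swap a k) = permStd (Equiv.swap a k)⁻¹ x + x := by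
    intro k
    rw [Equiv.swap_inv, permStd_swap, hx, add_right_comm, add_self_std, zero_add, hc]
    rcases eq_or_ne k a with hak | hak
    · rw [if_pos hak, hak, pairVec_self, smul_zero, smul_zero]
    · rw [if_neg hak]
  have hmul : ∀ σ τ, ψ σ = permStd σ⁻¹ x + x → ψ τ = permStd τ⁻¹ x + x →
      ψ (σ * τ) = permStd (σ * τ)⁻¹ x + x := by
    intro σ τ h h'
    rw [hψ, h, h', map_add, mul_inv_rev, permStd_mul, add_assoc, ← add_assoc (permStd τ⁻¹ x),
      add_self_std, zero_add]
  intro σ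
  refine Equiv.Perm.swap_induction_on σ ?_ fun σ i j hij h => hmul _ _ ?_ h
  · rw [hone, inv_one, permStd_one, add_self_std]
  · rcases eq_or_ne a i with rfl | hai
    · exact hstar j
    rcases eq_or_ne a j with rfl | haj
    · rw [Equiv.swap_comm]; exact hstar i
    · have : Equiv.swap i j = Equiv.swap a i * Equiv.swap a j * Equiv.swap a i := by
        rw [Equiv.swap_comm a j]
        exact (Equiv.swap_mul_swap_mul_swap haj.symm hij.symm).symm
      rw [this]
      exact hmul _ _ (hmul _ _ (hstar i) (hstar j)) (hstar i)

end Cohomology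

/-! ### Symbols of elements of congruence subgroups -/

section Symbols

variable {d : ℕ} {V : Type*} [AddCommGroup V] [Module ℤ_[2] V]
  {B : V →ₗ[ℤ_[2]] V →ₗ[ℤ_[2]] ℤ_[2]} {e : Red V 2 ≃+ StdSpace d}

/-- Reduction modulo `2`, with values in the standard representation. -/
noncomputable def redVec (e : Red V 2 ≃+ StdSpace d) : V →+ StdSpace d :=
  e.toAddMonoidHom.comp (multiples V 2).mkQ.toAddMonoidHom

theorem redVec_apply (v : V) : redVec e v = e ((multiples V 2).mkQ v) := rfl

theorem redVec_surjective : Function.Surjective (redVec e) :=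
  e.surjective.comp (multiples V 2).mkQ_surjective

theorem redVec_eq_zero {v : V} : redVec e v = 0 ↔ ∃ u, v = (2 : ℤ_[2]) • u := by
  rw [redVec_apply, map_eq_zero_iff e e.injective, Submodule.mkQ_apply,
    Submodule.Quotient.mk_eq_zero, mem_multiples]
  simp only [Nat.cast_ofNat, eq_comm]

theorem redVec_two_smul (u : V) : redVec e ((2 : ℤ_[2]) • u) = 0 := redVec_eq_zero.2 ⟨u, rfl⟩

theorem redVec_eq_iff {v w : V} : redVec e v = redVec e w ↔ ∃ u, v = w + (2 : ℤ_[2]) • u := by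
  rw [← sub_eq_zero, ← map_sub, redVec_eq_zero]
  simp only [sub_eq_iff_eq_add']

theorem toZMod_eq_zero {c : ℤ_[2]} : PadicInt.toZMod c = 0 ↔ ∃ b, c = 2 * b := by
  rw [← RingHom.mem_ker, PadicInt.ker_toZMod, PadicInt.maximalIdeal_eq_span_p,
    Ideal.mem_span_singleton]
  rfl

theorem redVec_smul (c : ℤ_[2]) (v : V) : redVec e (c • v) = PadicInt.toZMod c • redVec e v := by
  rcases zmod_two_cases (PadicInt.toZMod c) with h | h
  · obtain ⟨b, rfl⟩ := toZMod_eq_zero.1 h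
    rw [h, zero_smul, mul_smul, redVec_two_smul]
  · have h' : PadicInt.toZMod (c - 1) = 0 := by rw [map_sub, h, map_one, sub_self]
    obtain ⟨b, hb⟩ := toZMod_eq_zero.1 h'
    rw [h, one_smul, sub_eq_iff_eq_add.1 hb, add_smul, mul_smul, one_smul, map_add,
      redVec_two_smul, zero_add]

theorem redVec_pow_smul {n : ℕ} (hn : n ≠ 0) (v : V) :
    redVec e ((2 ^ n : ℤ_[2]) • v) = 0 := by
  obtain ⟨m, rfl⟩ := Nat.exists_eq_succ_of_ne_zero hn
  rw [pow_succ', mul_smul, redVec_two_smul]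

theorem two_pow_ne_zero' (n : ℕ) : (2 ^ n : ℤ_[2]) ≠ 0 := pow_ne_zero _ two_ne_zero

theorem two_pow_smul_injective [Module.Free ℤ_[2] V] (n : ℕ) {v w : V}
    (h : (2 ^ n : ℤ_[2]) • v = (2 ^ n : ℤ_[2]) • w) : v = w :=
  smul_right_injective V (two_pow_ne_zero' n) h

theorem mem_Gam {n : ℕ} {a : Sp B} :
    a ∈ Gam B (2 ^ n) ↔ ∀ v, ∃ w, a.1 v = v + (2 ^ n : ℤ_[2]) • w := by
  have hc : ((2 ^ n : ℕ) : ℤ_[2]) = 2 ^ n := by push_cast; rfl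
  have key : ∀ v : V, (∃ w, a.1 v = v + (2 ^ n : ℤ_[2]) • w) ↔
      redMap a.1 (2 ^ n) ((multiples V (2 ^ n)).mkQ v) = (multiples V (2 ^ n)).mkQ v := by
    intro v
    rw [redMap_mk, ← sub_eq_zero, ← map_sub, Submodule.mkQ_apply, Submodule.Quotient.mk_eq_zero,
      mem_multiples, hc]
    simp only [eq_sub_iff_add_eq', eq_comm]
  unfold Gam
  rw [MonoidHom.mem_ker]
  constructor
  · intro h v
    rw [key]
    exact LinearEquiv.congr_fun (congrArg Subtype.val h) _
  · intro h
    apply Subtype.ext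
    apply LinearEquiv.ext
    intro x
    obtain ⟨v, rfl⟩ := (multiples V (2 ^ n)).mkQ_surjective x
    exact (key v).1 (h v)

theorem Gam_antitone {m n : ℕ} (h : m ≤ n) : Gam B (2 ^ n) ≤ Gam B (2 ^ m) := by
  intro a ha
  rw [mem_Gam] at ha ⊢
  intro v
  obtain ⟨w, hw⟩ := ha v
  exact ⟨(2 ^ (n - m) : ℤ_[2]) • w, by rw [hw, smul_smul, ← pow_add, Nat.add_sub_cancel' h]⟩

theorem redSp_eq_iff {m : ℕ} {a b : Sp B} : redSp B m a = redSp B m b ↔ a⁻¹ * b ∈ Gam B m := by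
  unfold Gam
  rw [MonoidHom.mem_ker, map_mul, map_inv, inv_mul_eq_one]

theorem mul_val_apply (a b : Sp B) (v : V) : (a * b).1 v = a.1 (b.1 v) := rfl

theorem one_val_apply (v : V) : (1 : Sp B).1 v = v := rfl

theorem val_inv_apply (a : Sp B) (v : V) : a.1 (a⁻¹.1 v) = v := LinearEquiv.apply_symm_apply a.1 v

/-- `a ≡ 1 + 2 ^ n A` with `A` congruent to `X` modulo `2`. -/
def IsSymbol (e : Red V 2 ≃+ StdSpace d) (n : ℕ) (a : Sp B)
    (X : Module.End (ZMod 2) (StdSpace d)) : Prop :=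
  ∀ v, ∃ w, a.1 v = v + (2 ^ n : ℤ_[2]) • w ∧ redVec e w = X (redVec e v)

/-- `a` acts as the permutation `σ` on the standard representation. -/
def Lifts (e : Red V 2 ≃+ StdSpace d) (a : Sp B) (σ : Equiv.Perm (Fin d)) : Prop :=
  ∀ v, redVec e (a.1 v) = permStd σ (redVec e v)

theorem Lifts.mul {a b : Sp B} {σ τ : Equiv.Perm (Fin d)} (ha : Lifts e a σ) (hb : Lifts e b τ) :
    Lifts e (a * b) (σ * τ) := by
  intro v
  rw [mul_val_apply, ha, hb, permStd_mul]

theorem Lifts.inv {a : Sp B} {σ : Equiv.Perm (Fin d)} (ha : Lifts e a σ) : Lifts e a⁻¹ σ⁻¹ := by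
  intro v
  have h := ha (a⁻¹.1 v)
  rw [val_inv_apply] at h
  rw [h, permStd_inv_apply]

theorem lifts_one : Lifts e (1 : Sp B) 1 := fun v => by rw [one_val_apply, permStd_one]

section

variable {n : ℕ} {a b : Sp B} {X Y : Module.End (ZMod 2) (StdSpace d)}

theorem IsSymbol.mem_Gam (h : IsSymbol e n a X) : a ∈ Gam B (2 ^ n) :=
  _root_.mem_Gam.2 fun v => (h v).imp fun _ hw => hw.1

theorem isSymbol_zero_iff : IsSymbol e n a 0 ↔ a ∈ Gam B (2 ^ (n + 1)) := by
  rw [_root_.mem_Gam]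
  constructor
  · intro h v
    obtain ⟨w, hw, hw'⟩ := h v
    obtain ⟨u, rfl⟩ := redVec_eq_zero.1 hw'
    exact ⟨u, by rw [hw, smul_smul, ← pow_succ]⟩
  · intro h v
    obtain ⟨w, hw⟩ := h v
    exact ⟨(2 : ℤ_[2]) • w, by rw [hw, smul_smul, ← pow_succ], redVec_two_smul w⟩

theorem isSymbol_one : IsSymbol e n (1 : Sp B) 0 := isSymbol_zero_iff.2 (one_mem _)

theorem lifts_one_iff : Lifts e a 1 ↔ a ∈ Gam B 2 := by
  refine Iff.trans ?_ (_root_.mem_Gam (n := 1)).symm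
  refine forall_congr' fun v => ?_
  rw [permStd_one, redVec_eq_iff, pow_one]

theorem IsSymbol.lifts_one (hn : n ≠ 0) (h : IsSymbol e n a X) : Lifts e a 1 := by
  rw [lifts_one_iff]
  exact Gam_antitone (Nat.one_le_iff_ne_zero.2 hn) h.mem_Gam

theorem IsSymbol.redVec_apply (hn : n ≠ 0) (h : IsSymbol e n a X) (v : V) :
    redVec e (a.1 v) = redVec e v := by rw [h.lifts_one hn, permStd_one]

theorem IsSymbol.mul (hn : n ≠ 0) (ha : IsSymbol e n a X) (hb : IsSymbol e n b Y) :
    IsSymbol e n (a * b) (X + Y) := by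
  intro v
  obtain ⟨w, hw, hw'⟩ := hb v
  obtain ⟨u, hu, hu'⟩ := ha (b.1 v)
  refine ⟨w + u, by rw [mul_val_apply, hu, hw, smul_add, add_assoc], ?_⟩
  rw [map_add, hw', hu', hb.redVec_apply hn, LinearMap.add_apply, add_comm]

theorem IsSymbol.conj_of {Z : Module.End (ZMod 2) (StdSpace d)} (h : IsSymbol e n a X) (g : Sp B)
    (hZ : ∀ v, redVec e (g.1 v) = Z (redVec e v)) (hY : ∀ x, Y (Z x) = Z (X x)) :
    IsSymbol e n (g * a * g⁻¹) Y := by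
  intro v
  obtain ⟨w, hw, hw'⟩ := h (g⁻¹.1 v)
  refine ⟨g.1 w, ?_, ?_⟩
  · rw [mul_val_apply, mul_val_apply, hw, map_add, map_smul, val_inv_apply]
  · rw [hZ, hw', ← hY, ← hZ, val_inv_apply]

theorem IsSymbol.conj (h : IsSymbol e n a X) {g : Sp B} {σ : Equiv.Perm (Fin d)}
    (hg : Lifts e g σ) : IsSymbol e n (g * a * g⁻¹) (conjPerm σ X) :=
  h.conj_of g hg fun x => by rw [conjPerm_apply, permStd_inv_apply]

theorem conjPerm_one (X : Module.End (ZMod 2) (StdSpace d)) : conjPerm 1 X = X :=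
  LinearMap.ext fun x => by rw [conjPerm_apply, inv_one, permStd_one, permStd_one]

theorem IsSymbol.of_mul_mem_Gam (hn : n ≠ 0) (ha : IsSymbol e n a X)
    (h : a⁻¹ * b ∈ Gam B (2 ^ (n + 1))) : IsSymbol e n b X := by
  have := ha.mul hn (isSymbol_zero_iff (e := e).2 h)
  rwa [mul_inv_cancel_left, add_zero] at this

/-- The square of 1 + 2^n A is 1 + 2^(n+1) A + 2^(2n) A². For n ≥ 2 the last term does not affect
the symbol, while for n = 1 it contributes X². -/
theorem IsSymbol.sq (hn : 2 ≤ n) (ha : IsSymbol e n a X) : IsSymbol e (n + 1) (a * a) X := by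
  intro v
  obtain ⟨w, hw, hw'⟩ := ha v
  obtain ⟨u, hu, -⟩ := ha w
  refine ⟨w + (2 ^ (n - 1) : ℤ_[2]) • u, ?_, ?_⟩
  · rw [mul_val_apply, hw, map_add, map_smul, hw, hu, smul_add, smul_add, smul_smul, smul_smul,
      ← pow_add, ← pow_add, show n + 1 + (n - 1) = n + n by omega, pow_succ]
    module
  · rw [map_add, redVec_pow_smul (by omega), add_zero, hw']

theorem IsSymbol.sq_one (ha : IsSymbol e 1 a X) : IsSymbol e 2 (a * a) (X + X * X) := by
  intro v
  obtain ⟨w, hw, hw'⟩ := ha v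
  obtain ⟨u, hu, hu'⟩ := ha w
  refine ⟨w + u, ?_, ?_⟩
  · rw [mul_val_apply, hw, map_add, map_smul, hw, hu]
    module
  · rw [map_add, hw', hu', hw']
    rfl

/-- The difference ab - ba equals 2^(m+n) (A A' - A' A) for a = 1 + 2^m A and b = 1 + 2^n A'.
Dividing by ba, which is trivial modulo 2, does not change the symbol. -/
theorem IsSymbol.commutator {m : ℕ} (hm : m ≠ 0) (hn : n ≠ 0) (ha : IsSymbol e m a X)
    (hb : IsSymbol e n b Y) : IsSymbol e (m + n) (a * b * (b * a)⁻¹) (X * Y + Y * X) := by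
  intro v
  set u := (b * a)⁻¹.1 v with hu
  have hv : v = b.1 (a.1 u) := by rw [← mul_val_apply, hu, val_inv_apply]
  have huv : redVec e v = redVec e u := by
    rw [hv, hb.redVec_apply hn, ha.redVec_apply hm]
  obtain ⟨p, hp, hp'⟩ := ha u
  obtain ⟨q, hq, hq'⟩ := hb u
  obtain ⟨r, hr, hr'⟩ := ha q
  obtain ⟨s, hs, hs'⟩ := hb p
  refine ⟨r - s, ?_, ?_⟩
  · rw [mul_val_apply, mul_val_apply, ← hu, hv, hp, hq]
    simp only [map_add, map_smul, hp, hq, hr, hs, pow_add]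
    module
  · rw [map_sub, hr', hs', hq', hp', huv, sub_eq_add_neg, neg_std]
    rfl

/-- Compare first-order terms in B(av, aw) = B(v, w) after dividing by 2^n. The second-order term is
even because n ≥ 1. -/
theorem IsSymbol.mem_symEnd
    (he : ∀ v w : V, stdForm d (redVec e v) (redVec e w) = PadicInt.toZMod (B v w)) (hn : n ≠ 0)
    (ha : IsSymbol e n a X) :
    X ∈ symEnd d := by
  intro x y
  obtain ⟨v, rfl⟩ := redVec_surjective (e := e) x
  obtain ⟨w, rfl⟩ := redVec_surjective (e := e) y
  obtain ⟨p, hp, hp'⟩ := ha v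
  obtain ⟨q, hq, hq'⟩ := ha w
  rw [← hp', ← hq', he, he]
  have h := a.2 v w
  rw [hp, hq] at h
  simp only [map_add, map_smul, LinearMap.add_apply, LinearMap.smul_apply, smul_eq_mul] at h
  have h2 : (2 ^ n : ℤ_[2]) * (B p w + B v q + 2 ^ n * B p q) = 0 := by linear_combination h
  have h3 := (mul_eq_zero.1 h2).resolve_left (two_pow_ne_zero' n)
  have h4 := congrArg PadicInt.toZMod h3
  obtain ⟨m, rfl⟩ := Nat.exists_eq_succ_of_ne_zero hn
  have h5 : PadicInt.toZMod (2 : ℤ_[2]) = 0 := toZMod_eq_zero.2 ⟨1, by ring⟩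
  rw [map_add, map_add, map_mul, map_pow, h5, zero_pow hn, zero_mul, add_zero, map_zero] at h4
  exact CharTwo.add_eq_zero.1 h4

variable [Module.Free ℤ_[2] V]

theorem IsSymbol.unique (ha : IsSymbol e n a X) (hb : IsSymbol e n a Y) : X = Y := by
  refine LinearMap.ext fun x => ?_
  obtain ⟨v, rfl⟩ := redVec_surjective (e := e) x
  obtain ⟨w, hw, hw'⟩ := ha v
  obtain ⟨u, hu, hu'⟩ := hb v
  rw [← hw', ← hu', two_pow_smul_injective n (add_left_cancel (hw.symm.trans hu))]

/-- As V is torsion-free, the A in a = 1 + 2^n A is determined by a. Hence it is linear and descends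
modulo 2. -/
theorem exists_isSymbol (e : Red V 2 ≃+ StdSpace d) (ha : a ∈ Gam B (2 ^ n)) :
    ∃ X, IsSymbol e n a X := by
  choose A hA using _root_.mem_Gam.1 ha
  have hadd : ∀ v w, A (v + w) = A v + A w := by
    intro v w
    refine two_pow_smul_injective n (add_left_cancel (a := v + w) ?_)
    rw [← hA, map_add, hA, hA, smul_add]
    abel
  have hsmul : ∀ (c : ℤ_[2]) v, A (c • v) = c • A v := by
    intro c v
    refine two_pow_smul_injective n (add_left_cancel (a := c • v) ?_)
    rw [← hA, map_smul, hA, smul_add, smul_comm]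
  have hcongr : ∀ v w, redVec e v = redVec e w → redVec e (A v) = redVec e (A w) := by
    intro v w h
    obtain ⟨u, rfl⟩ := redVec_eq_iff.1 h
    rw [hadd, hsmul, map_add, redVec_two_smul, add_zero]
  let s : StdSpace d → V := Function.surjInv (redVec_surjective (e := e))
  have hs : ∀ x, redVec e (s x) = x := Function.surjInv_eq (redVec_surjective (e := e))
  let X : StdSpace d →+ StdSpace d := AddMonoidHom.mk' (fun x => redVec e (A (s x))) (by
    intro x y
    rw [← map_add, ← hadd]
    exact hcongr _ _ (by rw [map_add, hs, hs, hs]))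
  exact ⟨X.toZModLinearMap 2, fun v => ⟨A v, hA v, hcongr _ _ (hs _).symm⟩⟩

theorem IsSymbol.inv (hn : n ≠ 0) (ha : IsSymbol e n a X) : IsSymbol e n a⁻¹ X := by
  obtain ⟨Y, hY⟩ := exists_isSymbol e (inv_mem ha.mem_Gam)
  have h := ha.mul hn hY
  rw [mul_inv_cancel] at h
  have h' := h.unique isSymbol_one
  rw [eq_neg_of_add_eq_zero_left h', neg_end]
  exact hY

theorem IsSymbol.mem_Gam_succ_of_same (hn : n ≠ 0) (ha : IsSymbol e n a X)
    (hb : IsSymbol e n b X) : a⁻¹ * b ∈ Gam B (2 ^ (n + 1)) := by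
  rw [← isSymbol_zero_iff (e := e), ← add_self_end X]
  exact (ha.inv hn).mul hn hb

end

end Symbols

/-! ### The topology, transvections and layers -/

section Topology

variable {V : Type*} [AddCommGroup V] [Module ℤ_[2] V]
  {B : V →ₗ[ℤ_[2]] V →ₗ[ℤ_[2]] ℤ_[2]}

/-- The cosets aΓ(2^n) form a neighbourhood basis of a, directed because the Γ(2^n) decrease. -/
theorem mem_of_isClosed {G : Subgroup (Sp B)} (hG : IsClosed[twoAdic B] (G : Set (Sp B)))
    {a : Sp B} (h : ∀ n, ∃ g ∈ G, g⁻¹ * a ∈ Gam B (2 ^ n)) : a ∈ G := by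
  by_contra ha
  have hopen : IsOpen[twoAdic B] (G : Set (Sp B))ᶜ := hG.isOpen_compl
  have hnhds : (G : Set (Sp B))ᶜ ∈ @nhds _ (twoAdic B) a :=
    (@isOpen_iff_mem_nhds _ (twoAdic B) _).1 hopen a ha
  have hdir : Directed (· ≥ ·) fun n : ℕ => Filter.principal {b : Sp B | a⁻¹ * b ∈ Gam B (2 ^ n)} := by
    intro m n
    refine ⟨max m n, ?_, ?_⟩
    · exact Filter.principal_mono.2 fun b hb => Gam_antitone (le_max_left m n) hb
    · exact Filter.principal_mono.2 fun b hb => Gam_antitone (le_max_right m n) hb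
  have heq : @nhds _ (twoAdic B) a =
      ⨅ n : ℕ, Filter.principal {b : Sp B | a⁻¹ * b ∈ Gam B (2 ^ n)} := by
    unfold twoAdic
    rw [nhds_iInf]
    refine iInf_congr fun n => ?_
    rw [@nhds_induced _ _ ⊥, @nhds_discrete _ ⊥ (@DiscreteTopology.mk _ ⊥ rfl)]
    rw [← Filter.principal_singleton, Filter.comap_principal]
    congr 1
    ext b
    rw [Set.mem_preimage, Set.mem_singleton_iff, eq_comm, redSp_eq_iff]
    rfl
  rw [heq, Filter.mem_iInf_of_directed hdir] at hnhds
  obtain ⟨n, hn⟩ := hnhds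
  obtain ⟨g, hg, hga⟩ := h n
  have hga' := inv_mem hga
  rw [mul_inv_rev, inv_inv] at hga'
  exact Filter.mem_principal.1 hn hga' hg

theorem isOpen_of_Gam_le {G : Subgroup (Sp B)} (n : ℕ) (h : Gam B (2 ^ n) ≤ G) :
    IsOpen[twoAdic B] (G : Set (Sp B)) := by
  have hle : twoAdic B ≤ TopologicalSpace.induced (redSp B (2 ^ n)) ⊥ := iInf_le _ n
  refine hle _ ⟨redSp B (2 ^ n) '' G, trivial, ?_⟩
  ext a
  constructor
  · rintro ⟨g, hg, hga⟩
    have := mul_mem hg (h (redSp_eq_iff.1 hga))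
    rwa [mul_inv_cancel_left] at this
  · intro ha
    exact ⟨a, ha, rfl⟩

end Topology

/-! ### Transvections and lifts of permutations -/

section Transvections

variable {d : ℕ} {V : Type*} [AddCommGroup V] [Module ℤ_[2] V]
  {B : V →ₗ[ℤ_[2]] V →ₗ[ℤ_[2]] ℤ_[2]} {e : Red V 2 ≃+ StdSpace d}

theorem pairing_swap (hB : ∀ v, B v v = 0) (v w : V) : B v w = -B w v := by
  have h := hB (v + w)
  simp only [map_add, LinearMap.add_apply, hB, zero_add, add_zero] at h
  exact eq_neg_of_add_eq_zero_right h

/-- The transvection `v ↦ v + c ⟨v, u⟩ u`. -/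
noncomputable def transvection (hB : ∀ v, B v v = 0) (c : ℤ_[2]) (u : V) : Sp B :=
  ⟨LinearEquiv.ofLinearMap (LinearMap.id + (c • B.flip u).smulRight u)
      (LinearMap.id + (-c • B.flip u).smulRight u)
      (by
        refine LinearMap.ext fun v => ?_
        simp only [LinearMap.comp_apply, LinearMap.add_apply, LinearMap.id_apply,
          LinearMap.smulRight_apply, LinearMap.smul_apply, LinearMap.flip_apply, map_add, map_smul,
          hB, smul_eq_mul]
        module)
      (by
        refine LinearMap.ext fun v => ?_
        simp only [LinearMap.comp_apply, LinearMap.add_apply, LinearMap.id_apply,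
          LinearMap.smulRight_apply, LinearMap.smul_apply, LinearMap.flip_apply, map_add, map_smul,
          hB, smul_eq_mul]
        module), by
    intro v w
    change B (v + (c * B v u) • u) (w + (c * B w u) • u) = B v w
    simp only [map_add, map_smul, LinearMap.add_apply, LinearMap.smul_apply, smul_eq_mul, hB]
    rw [pairing_swap hB u w]
    ring⟩

variable (hB : ∀ v, B v v = 0)

theorem transvection_apply (c : ℤ_[2]) (u v : V) :
    (transvection hB c u).1 v = v + (c * B v u) • u := rfl

theorem Sp_ext {a b : Sp B} (h : ∀ v, a.1 v = b.1 v) : a = b :=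
  Subtype.ext (LinearEquiv.ext h)

theorem transvection_mul (c c' : ℤ_[2]) (u : V) :
    transvection hB c u * transvection hB c' u = transvection hB (c + c') u := by
  refine Sp_ext fun v => ?_
  rw [mul_val_apply]
  simp only [transvection_apply, map_add, map_smul, hB]
  module

theorem transvection_commute (c c' : ℤ_[2]) {u u' : V} (h : B u u' = 0) :
    transvection hB c u * transvection hB c' u' = transvection hB c' u' * transvection hB c u := by
  have h' : B u' u = 0 := by rw [pairing_swap hB, h, neg_zero]
  refine Sp_ext fun v => ?_
  rw [mul_val_apply, mul_val_apply]
  simp only [transvection_apply, map_add, map_smul, h, h']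
  module

theorem isSymbol_transvection
    (he : ∀ v w : V, stdForm d (redVec e v) (redVec e w) = PadicInt.toZMod (B v w))
    (n : ℕ) (u : V) :
    IsSymbol e n (transvection hB (2 ^ n) u) (sqEnd (redVec e u)) := by
  intro v
  refine ⟨B v u • u, by rw [transvection_apply, mul_smul], ?_⟩
  rw [redVec_smul, sqEnd_apply, he]

theorem lifts_transvection
    (he : ∀ v w : V, stdForm d (redVec e v) (redVec e w) = PadicInt.toZMod (B v w))
    {i j : Fin d} {u : V} (hu : redVec e u = pairVec i j) :
    Lifts e (transvection hB 1 u) (Equiv.swap i j) := by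
  intro v
  rw [transvection_apply, map_add, redVec_smul, one_mul, ← he, permStd_swap, hu]

theorem Lifts.of_redSp_eq {a b : Sp B} {σ : Equiv.Perm (Fin d)} (ha : Lifts e a σ)
    (h : redSp B 2 a = redSp B 2 b) : Lifts e b σ := by
  have h1 := ha.mul (lifts_one_iff.2 (redSp_eq_iff.1 h))
  rwa [mul_inv_cancel_left, mul_one] at h1

theorem redSp_mem_stdImage_iff {a : Sp B} :
    redSp B 2 a ∈ stdImage B d e ↔ ∃ σ, Lifts e a σ := by
  constructor
  · rintro ⟨s, ⟨σ, rfl⟩, h⟩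
    exact ⟨σ, fun v => h ((multiples V 2).mkQ v)⟩
  · rintro ⟨σ, h⟩
    refine ⟨stdRep d σ, ⟨σ, rfl⟩, fun x => ?_⟩
    obtain ⟨v, rfl⟩ := (multiples V 2).mkQ_surjective x
    exact h v

/-- Integral transvections show that transpositions come from Sp(V), so the hypothesis on the image
of G applies to their reductions. Products then give every permutation. -/
theorem exists_lifts (hB : ∀ v, B v v = 0)
    (he : ∀ v w : V, stdForm d (redVec e v) (redVec e w) = PadicInt.toZMod (B v w))
    {G : Subgroup (Sp B)} (hG : stdImage B d e ≤ G.map (redSp B 2))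
    (σ : Equiv.Perm (Fin d)) : ∃ g ∈ G, Lifts e g σ := by
  refine Equiv.Perm.swap_induction_on σ ⟨1, one_mem _, lifts_one⟩ ?_
  rintro τ i j - ⟨g, hg, hgτ⟩
  obtain ⟨u, hu⟩ := redVec_surjective (e := e) (pairVec i j)
  have ht := lifts_transvection hB he hu
  obtain ⟨t, htG, htu⟩ := hG (redSp_mem_stdImage_iff.2 ⟨_, ht⟩)
  exact ⟨t * g, mul_mem htG hg, (ht.of_redSp_eq htu.symm).mul hgτ⟩

end Transvections

/-! ### Layers of a subgroup and successive approximation -/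

section Layers

variable {d : ℕ} {V : Type*} [AddCommGroup V] [Module ℤ_[2] V]
  {B : V →ₗ[ℤ_[2]] V →ₗ[ℤ_[2]] ℤ_[2]} {e : Red V 2 ≃+ StdSpace d}

/-- The symbols of the elements of `G ∩ Γ(2 ^ (n + 1))`. -/
def layer (e : Red V 2 ≃+ StdSpace d) (G : Subgroup (Sp B)) (n : ℕ) :
    AddSubgroup (Module.End (ZMod 2) (StdSpace d)) where
  carrier := {X | ∃ a ∈ G, IsSymbol e (n + 1) a X}
  add_mem' := by
    rintro X Y ⟨a, ha, hX⟩ ⟨b, hb, hY⟩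
    exact ⟨a * b, mul_mem ha hb, hX.mul n.succ_ne_zero hY⟩
  zero_mem' := ⟨1, one_mem _, isSymbol_one⟩
  neg_mem' := by intro X hX; rwa [neg_end]

variable {G : Subgroup (Sp B)} {n : ℕ}

theorem permStable_layer (hG : ∀ σ, ∃ g ∈ G, Lifts e g σ) : PermStable (layer e G n) := by
  rintro σ X ⟨a, ha, hX⟩
  obtain ⟨g, hg, hgσ⟩ := hG σ
  exact ⟨g * a * g⁻¹, mul_mem (mul_mem hg ha) (inv_mem hg), hX.conj hgσ⟩

theorem layer_le_symEnd
    (he : ∀ v w : V, stdForm d (redVec e v) (redVec e w) = PadicInt.toZMod (B v w)) :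
    layer e G n ≤ symEnd d := by
  rintro X ⟨a, -, hX⟩
  exact hX.mem_symEnd he n.succ_ne_zero

theorem layer_le_layer_succ (hn : n ≠ 0) : layer e G n ≤ layer e G (n + 1) := by
  rintro X ⟨a, ha, hX⟩
  exact ⟨a * a, mul_mem ha ha, hX.sq (by omega)⟩

theorem layer_le_layer {m : ℕ} (hn : n ≠ 0) (hnm : n ≤ m) : layer e G n ≤ layer e G m := by
  induction m, hnm using Nat.le_induction with
  | base => exact le_rfl
  | succ k hk ih => exact ih.trans (layer_le_layer_succ (by omega))

theorem add_sq_mem_layer_one {X : Module.End (ZMod 2) (StdSpace d)} (hX : X ∈ layer e G 0) :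
    X + X * X ∈ layer e G 1 := by
  obtain ⟨a, ha, hX⟩ := hX
  exact ⟨a * a, mul_mem ha ha, hX.sq_one⟩

/-- Squaring from Γ(2) to Γ(4) sends the symbol X to X + X². The endomorphism v_ij ⊗ v_ij has square
zero and therefore survives. -/
theorem symEnd_le_layer_one (hd : 5 ≤ d) (hG : ∀ σ, ∃ g ∈ G, Lifts e g σ)
    (h : symEnd d ≤ layer e G 0) : symEnd d ≤ layer e G 1 := by
  let i : Fin d := ⟨0, by omega⟩
  let j : Fin d := ⟨1, by omega⟩
  refine (permStable_layer hG).symEnd_le (i := i) (j := j) (by simp [i, j]) ?_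
  have h1 := add_sq_mem_layer_one (h (sqEnd_mem_symEnd (pairVec i j)))
  have h2 : sqEnd (pairVec i j) * sqEnd (pairVec i j) = 0 := by
    refine LinearMap.ext fun x => ?_
    rw [Module.End.mul_apply, sqEnd_apply _ x, map_smul, sqEnd_apply, stdForm_self, zero_smul,
      smul_zero]
    rfl
  rwa [h2, add_zero] at h1

variable [Module.Free ℤ_[2] V]

theorem Gam_le_of_layers
    (he : ∀ v w : V, stdForm d (redVec e v) (redVec e w) = PadicInt.toZMod (B v w))
    (hG : IsClosed[twoAdic B] (G : Set (Sp B)))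
    (h : ∀ m, n ≤ m → symEnd d ≤ layer e G m) : Gam B (2 ^ (n + 1)) ≤ G := by
  intro a ha
  have key : ∀ k, ∃ g ∈ G, g⁻¹ * a ∈ Gam B (2 ^ (n + 1 + k)) := by
    intro k
    induction k with
    | zero => exact ⟨1, one_mem _, by rwa [inv_one, one_mul]⟩
    | succ k ih =>
      obtain ⟨g, hg, hga⟩ := ih
      obtain ⟨X, hX⟩ := exists_isSymbol e hga
      obtain ⟨b, hb, hbX⟩ := h (n + k) (by omega) (hX.mem_symEnd he (by omega))
      refine ⟨g * b, mul_mem hg hb, ?_⟩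
      rw [mul_inv_rev, mul_assoc]
      rw [show n + k + 1 = n + 1 + k by omega] at hbX
      exact hbX.mem_Gam_succ_of_same (n := n + 1 + k) (by omega) hX
  refine mem_of_isClosed hG fun k => ?_
  obtain ⟨g, hg, hga⟩ := key k
  exact ⟨g, hg, Gam_antitone (Nat.le_add_left k (n + 1)) hga⟩

end Layers

/-! ### The first two layers -/

section LowLayers

variable {d : ℕ} {V : Type*} [AddCommGroup V] [Module ℤ_[2] V]
  {B : V →ₗ[ℤ_[2]] V →ₗ[ℤ_[2]] ℤ_[2]} {e : Red V 2 ≃+ StdSpace d} {G : Subgroup (Sp B)}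

theorem isUnit_of_toZMod_eq_one {c : ℤ_[2]} (h : PadicInt.toZMod c = 1) : IsUnit c := by
  by_contra hc
  have := (IsLocalRing.mem_maximalIdeal c).2 hc
  rw [← PadicInt.ker_toZMod, RingHom.mem_ker, h] at this
  exact one_ne_zero this

/-- Any lift u of y has B(v, u) even. It is corrected by an even multiple of a vector whose pairing
with v is a unit, which leaves the reduction unchanged. -/
theorem exists_lift_orthogonal
    (he : ∀ v w : V, stdForm d (redVec e v) (redVec e w) = PadicInt.toZMod (B v w))
    {v : V} {x y : StdSpace d} (hx : stdForm d (redVec e v) x = 1)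
    (hy : stdForm d (redVec e v) y = 0) : ∃ u, redVec e u = y ∧ B v u = 0 := by
  obtain ⟨h, rfl⟩ := redVec_surjective (e := e) x
  obtain ⟨u, rfl⟩ := redVec_surjective (e := e) y
  rw [he] at hx hy
  obtain ⟨c, hc⟩ := isUnit_of_toZMod_eq_one hx
  refine ⟨u - (B v u * ↑c⁻¹) • h, ?_, ?_⟩
  · rw [map_sub, redVec_smul, map_mul, hy, zero_mul, zero_smul, sub_zero]
  · rw [map_sub, map_smul, smul_eq_mul, ← hc, Units.inv_mul_cancel_right, sub_self]

theorem exists_lift_orthogonal_pair (hB : ∀ v, B v v = 0)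
    (he : ∀ v w : V, stdForm d (redVec e v) (redVec e w) = PadicInt.toZMod (B v w))
    {v w : V} {y : StdSpace d} (hvw : stdForm d (redVec e v) (redVec e w) = 1)
    (hv : stdForm d (redVec e v) y = 0) (hw : stdForm d (redVec e w) y = 0) :
    ∃ u, redVec e u = y ∧ B v u = 0 ∧ B w u = 0 := by
  obtain ⟨u, rfl⟩ := redVec_surjective (e := e) y
  rw [he] at hvw hv hw
  obtain ⟨c, hc⟩ := isUnit_of_toZMod_eq_one hvw
  refine ⟨u - (B v u * ↑c⁻¹) • w + (B w u * ↑c⁻¹) • v, ?_, ?_, ?_⟩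
  · rw [map_add, map_sub, redVec_smul, redVec_smul, map_mul, map_mul, hv, hw, zero_mul, zero_smul,
      sub_zero, zero_smul, add_zero]
  · rw [map_add, map_sub, map_smul, map_smul, hB, smul_zero, add_zero, smul_eq_mul, ← hc,
      Units.inv_mul_cancel_right, sub_self]
  · rw [map_add, map_sub, map_smul, map_smul, hB, smul_zero, sub_zero, smul_eq_mul,
      pairing_swap hB w v, ← hc, mul_neg, Units.inv_mul_cancel_right, add_neg_cancel]

/-- Sum y_k + y_m over all k. Only k = i and k = j contribute, giving 1, while the coordinate sum of
y is zero. The parity of d decides whether this is possible. -/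
theorem pairVec_sum_eq {i j m : Fin d} (hij : i ≠ j) (him : i ≠ m) (hjm : j ≠ m) (y : sumZero d)
    (h1 : stdForm d ((onesLine d).mkQ y) (pairVec i j) = 1)
    (h0 : ∀ k l, i ≠ k → j ≠ k → i ≠ l → j ≠ l →
      stdForm d ((onesLine d).mkQ y) (pairVec k l) = 0) : (d : ZMod 2) * y.1 m = 1 := by
  rw [stdForm_mk_pairVec] at h1
  have hy : ∑ k, y.1 k = 0 := y.2
  have hsum : ∑ k, (y.1 k + y.1 m) = y.1 i + y.1 m + (y.1 j + y.1 m) := by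
    refine Finset.sum_eq_add i j hij (fun k _ hk => ?_) (fun h => absurd (Finset.mem_univ _) h)
      (fun h => absurd (Finset.mem_univ _) h)
    rw [← stdForm_mk_pairVec]
    exact h0 k m hk.1.symm hk.2.symm him hjm
  rw [Finset.sum_add_distrib, hy, Finset.sum_const, Finset.card_univ, Fintype.card_fin,
    nsmul_eq_mul, zero_add] at hsum
  rw [hsum]
  linear_combination h1 + CharTwo.add_self_eq_zero (y.1 m)

/-- The pairing of the diagonals of lifts of two disjoint transpositions. -/
theorem stdForm_eq_one_of_diag (hd : Odd d) {i j k l m : Fin d} (hij : i ≠ j) (hik : i ≠ k)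
    (hil : i ≠ l) (hjk : j ≠ k) (hjl : j ≠ l) (hkl : k ≠ l) (him : i ≠ m) (hjm : j ≠ m)
    {w w' : StdSpace d}
    (h1 : stdForm d w (pairVec i j) = 1)
    (h0 : ∀ a b, i ≠ a → j ≠ a → i ≠ b → j ≠ b → stdForm d w (pairVec a b) = 0)
    (h1' : stdForm d w' (pairVec k l) = 1)
    (h0' : ∀ a b, k ≠ a → l ≠ a → k ≠ b → l ≠ b → stdForm d w' (pairVec a b) = 0) :
    stdForm d w w' = 1 := by
  obtain ⟨y, rfl⟩ := (onesLine d).mkQ_surjective w'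
  have hd' : (d : ZMod 2) = 1 := (ZMod.natCast_eq_one_iff_odd).2 hd
  have hi := pairVec_sum_eq hkl hik.symm hil.symm y h1' h0'
  have hj := pairVec_sum_eq hkl hjk.symm hjl.symm y h1' h0'
  rw [hd', one_mul] at hi hj
  -- The coordinates of w' at i and j are 1. Since w is orthogonal to the other v_mn, the pairing
  -- becomes ⟨w, v_mi + v_mj⟩ = ⟨w, v_ij⟩.
  rw [mkQ_eq_sum_pairVec y m, map_sum, Finset.sum_eq_add i j hij]
  · rw [map_smul, map_smul, hi, hj, one_smul, one_smul, ← h1, stdForm_pairVec_eq_add w i j m]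
  · rintro n - ⟨hni, hnj⟩
    rw [map_smul, h0 m n him hjm hni.symm hnj.symm, smul_zero]
  · exact fun h => absurd (Finset.mem_univ _) h
  · exact fun h => absurd (Finset.mem_univ _) h

theorem Lifts.exists_isSymbol [Module.Free ℤ_[2] V] {t T : Sp B} {σ : Equiv.Perm (Fin d)}
    (ht : Lifts e t σ) (hT : Lifts e T σ) : ∃ X, IsSymbol e 1 (T⁻¹ * t) X := by
  have h := hT.inv.mul ht
  rw [inv_mul_cancel, lifts_one_iff] at h
  exact _root_.exists_isSymbol (n := 1) e h

/-- With T the transvection, (Ta)² = T² · (T⁻¹aT) · a. The factor T² contributes v_ij ⊗ v_ij, which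
is the source of the 1 in the coefficient. -/
theorem IsSymbol.sq_of_swap (hB : ∀ v, B v v = 0)
    (he : ∀ v w : V, stdForm d (redVec e v) (redVec e w) = PadicInt.toZMod (B v w))
    {i j : Fin d} {v : V} (hv : redVec e v = pairVec i j) {a : Sp B}
    {X : Module.End (ZMod 2) (StdSpace d)} (ha : IsSymbol e 1 a X) :
    IsSymbol e 1 (transvection hB 1 v * a * (transvection hB 1 v * a))
      (wedgeEnd (pairVec i j) (X (pairVec i j)) +
        (1 + stdForm d (X (pairVec i j)) (pairVec i j)) • sqEnd (pairVec i j)) := by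
  have hT := lifts_transvection hB he hv
  have h1 := isSymbol_transvection hB he 1 v
  rw [pow_one, hv] at h1
  have h2 := (h1.mul one_ne_zero (ha.conj hT.inv)).mul one_ne_zero ha
  rw [Equiv.swap_inv] at h2
  convert h2 using 1
  · rw [show (2 : ℤ_[2]) = 1 + 1 by norm_num, ← transvection_mul]
    group
  · rw [add_assoc, add_comm (conjPerm _ _), add_conjPerm_swap (ha.mem_symEnd he one_ne_zero),
      add_smul, one_smul]
    abel

/-- The symbol of a commutator, for elements `R a` and `R' a'`. -/
theorem IsSymbol.commutator_of_lifts [Module.Free ℤ_[2] V] {n : ℕ} (hn : n ≠ 0)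
    {R R' a a' : Sp B}
    {σ σ' : Equiv.Perm (Fin d)} (hR : Lifts e R σ) (hR' : Lifts e R' σ')
    {X X' Z : Module.End (ZMod 2) (StdSpace d)}
    (hZ : IsSymbol e n ((R' * R)⁻¹ * (R * R')) Z) (ha : IsSymbol e n a X)
    (ha' : IsSymbol e n a' X') :
    IsSymbol e n ((R' * a' * (R * a))⁻¹ * (R * a * (R' * a')))
      (Z + (X + conjPerm σ'⁻¹ X) + (X' + conjPerm σ⁻¹ X')) := by
  have h1 := ((ha'.conj hR.inv).mul hn ha).inv hn
  have h2 := (ha.conj hR'.inv).mul hn ha'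
  have h3 := (h1.mul hn hZ).mul hn h2
  convert h3 using 1
  · group
  · abel

theorem altEnd_le_layer_zero [Module.Free ℤ_[2] V] (hd : 5 ≤ d) (hB : ∀ v, B v v = 0)
    (he : ∀ v w : V, stdForm d (redVec e v) (redVec e w) = PadicInt.toZMod (B v w))
    (hG : ∀ σ, ∃ g ∈ G, Lifts e g σ) : altEnd d ≤ layer e G 0 := by
  let i : Fin d := ⟨0, by omega⟩
  let j : Fin d := ⟨1, by omega⟩
  have hij : i ≠ j := by simp [i, j]
  obtain ⟨t, ht, htσ⟩ := hG (Equiv.swap i j)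
  obtain ⟨v, hv⟩ := redVec_surjective (e := e) (pairVec i j)
  obtain ⟨X, hX⟩ := htσ.exists_isSymbol (lifts_transvection hB he hv)
  refine (permStable_layer hG).altEnd_le_of_square hd hij (X (pairVec i j))
    ⟨_, ?_, hX.sq_of_swap hB he hv⟩
  rw [mul_inv_cancel_left]
  exact mul_mem ht ht

/-- The diagonal of a lift of a transposition, when the first layer is alternating. -/
theorem diag_of_swap [Module.Free ℤ_[2] V] (hd : 5 ≤ d) (hB : ∀ v, B v v = 0)
    (he : ∀ v w : V, stdForm d (redVec e v) (redVec e w) = PadicInt.toZMod (B v w))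
    (hG : ∀ σ, ∃ g ∈ G, Lifts e g σ) (hlayer : layer e G 0 ≤ altEnd d) {i j : Fin d}
    (hij : i ≠ j) {v : V} (hv : redVec e v = pairVec i j) {a : Sp B}
    (haG : transvection hB 1 v * a ∈ G) {X : Module.End (ZMod 2) (StdSpace d)}
    (ha : IsSymbol e 1 a X) :
    stdForm d (X (pairVec i j)) (pairVec i j) = 1 ∧
      ∀ k l, i ≠ k → j ≠ k → i ≠ l → j ≠ l → stdForm d (X (pairVec k l)) (pairVec k l) = 0 := by
  have hT := lifts_transvection hB he hv
  constructor
  -- The wedge part of the symbol of the square is alternating, so the coefficient of v_ij ⊗ v_ij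
  -- has to vanish.
  · have h := hlayer ⟨_, mul_mem haG haG, ha.sq_of_swap hB he hv⟩
    have h1 := (altEnd d).sub_mem h (wedgeEnd_mem_altEnd (pairVec i j) (X (pairVec i j)))
    rw [add_sub_cancel_left] at h1
    obtain ⟨m, him, hjm⟩ := exists_fin_ne_two hd i j
    have h2 := h1 (pairVec i m)
    rw [LinearMap.smul_apply, map_smul, LinearMap.smul_apply, stdForm_sqEnd,
      stdForm_comm (pairVec i m), stdForm_pairVec_of_common hij him hjm, smul_eq_mul, mul_one] at h2
    exact (CharTwo.add_eq_zero.1 h2).symm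
  · intro k l hik hjk hil hjl
    rcases eq_or_ne k l with rfl | hkl
    · rw [pairVec_self, map_zero]
    obtain ⟨m, him, hjm, hkm, hlm⟩ := exists_fin_ne_four hd i j k l
    -- Exact orthogonality makes the two transvections commute, so only X and X' enter the symbol of
    -- the commutator.
    obtain ⟨v', hv', hvv'⟩ := exists_lift_orthogonal he (v := v) (x := pairVec i k)
      (y := pairVec k l) (by
        rw [hv, stdForm_pairVec_of_common hij hik hjk]) (by
        rw [hv, stdForm_pairVec_of_disjoint hik hil hjk hjl])
    have hT' := lifts_transvection hB he hv'
    obtain ⟨t', ht', htσ'⟩ := hG (Equiv.swap k l)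
    obtain ⟨X', hX'⟩ := htσ'.exists_isSymbol hT'
    have hZ : IsSymbol e 1 ((transvection hB 1 v' * transvection hB 1 v)⁻¹ *
        (transvection hB 1 v * transvection hB 1 v')) 0 := by
      rw [transvection_commute hB 1 1 hvv', inv_mul_cancel]
      exact isSymbol_one
    have h := IsSymbol.commutator_of_lifts one_ne_zero hT hT' hZ ha hX'
    rw [Equiv.swap_inv, Equiv.swap_inv, add_conjPerm_swap (ha.mem_symEnd he one_ne_zero),
      add_conjPerm_swap (hX'.mem_symEnd he one_ne_zero), mul_inv_cancel_left, zero_add] at h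
    -- The diagonal of this symbol is a multiple of v_kl plus a multiple of v_ij. Evaluation at v_km
    -- reads off the coefficient of v_kl, which is ⟨X v_kl, v_kl⟩.
    have h1 := hlayer ⟨_, mul_mem (inv_mem (mul_mem ht' haG)) (mul_mem haG ht'), h⟩ (pairVec k m)
    have hw := fun x y => wedgeEnd_mem_altEnd (d := d) x y (pairVec k m)
    simp only [LinearMap.add_apply, map_add, LinearMap.smul_apply, map_smul, hw, stdForm_sqEnd,
      stdForm_pairVec_of_common hkl hkm hlm, stdForm_comm (pairVec k m),
      stdForm_pairVec_of_disjoint hik him hjk hjm] at h1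
    simpa using h1

/-- For even `d` the first layer is everything. -/
theorem symEnd_le_layer_zero [Module.Free ℤ_[2] V] (hd : 5 ≤ d) (heven : Even d)
    (hB : ∀ v, B v v = 0)
    (he : ∀ v w : V, stdForm d (redVec e v) (redVec e w) = PadicInt.toZMod (B v w))
    (hG : ∀ σ, ∃ g ∈ G, Lifts e g σ) : symEnd d ≤ layer e G 0 := by
  refine (permStable_layer hG).symEnd_le_of_not_altEnd (layer_le_symEnd he)
    (altEnd_le_layer_zero hd hB he hG) fun hlayer => ?_
  let i : Fin d := ⟨0, by omega⟩
  let j : Fin d := ⟨1, by omega⟩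
  have hij : i ≠ j := by simp [i, j]
  obtain ⟨m, him, hjm⟩ := exists_fin_ne_two hd i j
  obtain ⟨t, ht, htσ⟩ := hG (Equiv.swap i j)
  obtain ⟨v, hv⟩ := redVec_surjective (e := e) (pairVec i j)
  obtain ⟨X, hX⟩ := htσ.exists_isSymbol (lifts_transvection hB he hv)
  obtain ⟨h1, h0⟩ := diag_of_swap hd hB he hG hlayer hij hv
    (by rw [mul_inv_cancel_left]; exact ht) hX
  obtain ⟨w, hw⟩ := exists_diag (hX.mem_symEnd he one_ne_zero)
  obtain ⟨y, rfl⟩ := (onesLine d).mkQ_surjective w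
  simp only [hw, stdForm_comm (pairVec _ _)] at h1 h0
  have h := pairVec_sum_eq hij him hjm y h1 h0
  rw [(ZMod.natCast_eq_zero_iff_even).2 heven, zero_mul] at h
  exact zero_ne_one h

/-- When the first layer is alternating, every transposition has a lift of a particular form
modulo `4`. -/
theorem exists_swap_lift [Module.Free ℤ_[2] V] (hd : 5 ≤ d) (hB : ∀ v, B v v = 0)
    (he : ∀ v w : V, stdForm d (redVec e v) (redVec e w) = PadicInt.toZMod (B v w))
    (hG : ∀ σ, ∃ g ∈ G, Lifts e g σ) (hlayer : layer e G 0 ≤ altEnd d) {i j : Fin d}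
    (hij : i ≠ j) {v : V} (hv : redVec e v = pairVec i j) :
    ∃ w, stdForm d w (pairVec i j) = 1 ∧
      (∀ k l, i ≠ k → j ≠ k → i ≠ l → j ≠ l → stdForm d w (pairVec k l) = 0) ∧
      ∀ W, redVec e W = w → ∃ a ∈ Gam B (2 ^ 2),
        transvection hB 1 v * transvection hB 2 W * a ∈ G := by
  obtain ⟨t, ht, htσ⟩ := hG (Equiv.swap i j)
  obtain ⟨X, hX⟩ := htσ.exists_isSymbol (lifts_transvection hB he hv)
  obtain ⟨h1, h0⟩ := diag_of_swap hd hB he hG hlayer hij hv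
    (by rw [mul_inv_cancel_left]; exact ht) hX
  obtain ⟨w, hw⟩ := exists_diag (hX.mem_symEnd he one_ne_zero)
  simp only [hw, stdForm_comm (pairVec _ _)] at h1 h0
  refine ⟨w, h1, h0, fun W hW => ?_⟩
  -- The alternating part X + w ⊗ w is the symbol of an element of G. Multiplying by it leaves the
  -- symbol w ⊗ w, that of the transvection with coefficient 2 along W.
  obtain ⟨g, hg, hgX⟩ := altEnd_le_layer_zero hd hB he hG (add_sqEnd_mem_altEnd hw)
  have h2 := hX.mul one_ne_zero hgX
  rw [← add_assoc, add_self_end, zero_add] at h2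
  have h3 := isSymbol_transvection hB he 1 W
  rw [pow_one, hW] at h3
  refine ⟨_, h3.mem_Gam_succ_of_same one_ne_zero h2, ?_⟩
  rw [mul_assoc, mul_inv_cancel_left, mul_assoc, mul_inv_cancel_left]
  exact mul_mem ht hg

/-- For orthogonal x and y the square of x ∧ y is zero, so x ∧ y survives squaring from Γ(2) to
Γ(4). -/
theorem containsDisjoint_layer_one (h : altEnd d ≤ layer e G 0) :
    ContainsDisjoint (layer e G 1) := by
  intro i j k l hik hil hjk hjl
  have h1 := add_sq_mem_layer_one (h (wedgeEnd_mem_altEnd (pairVec i j) (pairVec k l)))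
  have h2 : wedgeEnd (pairVec i j) (pairVec k l) * wedgeEnd (pairVec i j) (pairVec k l) = 0 := by
    refine LinearMap.ext fun x => ?_
    rw [Module.End.mul_apply, wedgeEnd_apply _ _ x, map_add, map_smul, map_smul, wedgeEnd_apply,
      wedgeEnd_apply, stdForm_self, stdForm_self, stdForm_comm (pairVec k l),
      stdForm_pairVec_of_disjoint hik hil hjk hjl]
    simp
  rwa [h2, add_zero] at h1

theorem sqEnd_mul_add_mul {w w' : StdSpace d} (h : stdForm d w w' = 1) :
    sqEnd w * sqEnd w' + sqEnd w' * sqEnd w = wedgeEnd w w' := by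
  refine LinearMap.ext fun x => ?_
  rw [LinearMap.add_apply, Module.End.mul_apply, Module.End.mul_apply, sqEnd_apply w' x,
    sqEnd_apply w x, map_smul, map_smul, sqEnd_apply, sqEnd_apply, wedgeEnd_apply,
    stdForm_comm w' w, h, one_smul, one_smul, add_comm]

theorem mul_mul_mul_comm_of_commute {H : Type*} [Group H] {a b c f : H} (h : b * c = c * b) :
    a * b * (c * f) = a * c * (b * f) := by
  rw [mul_assoc, ← mul_assoc b, h, mul_assoc c, ← mul_assoc a]

/-- Lifts of two disjoint transpositions have diagonals w, w' with ⟨w, w'⟩ = 1. Their commutator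
lies in Γ(4), and its symbol contains w ∧ w' besides the corrections from Γ(4);
`PermStable.altEnd_le_of_commutator` is made for this shape. -/
theorem altEnd_le_layer_one [Module.Free ℤ_[2] V] (hd : 5 ≤ d) (hodd : Odd d)
    (hB : ∀ v, B v v = 0)
    (he : ∀ v w : V, stdForm d (redVec e v) (redVec e w) = PadicInt.toZMod (B v w))
    (hG : ∀ σ, ∃ g ∈ G, Lifts e g σ) (hlayer : layer e G 0 ≤ altEnd d) :
    altEnd d ≤ layer e G 1 := by
  obtain ⟨i, j, hij⟩ : ∃ i j : Fin d, i ≠ j := ⟨⟨0, by omega⟩, ⟨1, by omega⟩, by simp⟩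
  obtain ⟨k, hik, hjk⟩ := exists_fin_ne_two hd i j
  obtain ⟨l, hil, hjl, hkl⟩ := exists_fin_ne_three hd i j k
  obtain ⟨m, him, hjm, hkm, hlm⟩ := exists_fin_ne_four hd i j k l
  obtain ⟨v, hv⟩ := redVec_surjective (e := e) (pairVec i j)
  obtain ⟨w, hw1, hw0, hwG⟩ := exists_swap_lift hd hB he hG hlayer hij hv
  obtain ⟨W, rfl⟩ := redVec_surjective (e := e) w
  obtain ⟨a, ha, haG⟩ := hwG W rfl
  -- The order of choices matters, as w' depends on v'. With v' orthogonal to v and W, and W'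
  -- orthogonal to v, the transvections along W and W' are the only ones from different lifts that
  -- need not commute.
  obtain ⟨v', hv', hvv', hWv'⟩ := exists_lift_orthogonal_pair hB he (v := v) (w := W)
    (y := pairVec k l) (by rw [hv, stdForm_comm, hw1])
    (by rw [hv, stdForm_pairVec_of_disjoint hik hil hjk hjl])
    (hw0 k l hik hjk hil hjl)
  obtain ⟨w', hw1', hw0', hwG'⟩ := exists_swap_lift hd hB he hG hlayer hkl hv'
  obtain ⟨W', rfl, hvW'⟩ := exists_lift_orthogonal he (v := v) (x := redVec e W)
    (y := w') (by rw [hv, stdForm_comm, hw1]) (by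
      rw [hv, stdForm_comm]
      exact hw0' i j hik.symm hil.symm hjk.symm hjl.symm)
  obtain ⟨a', ha', haG'⟩ := hwG' W' rfl
  have hww' := stdForm_eq_one_of_diag hodd hij hik hil hjk hjl hkl him hjm hw1 hw0 hw1' hw0'
  have hS := isSymbol_transvection hB he 1 W
  have hS' := isSymbol_transvection hB he 1 W'
  rw [pow_one] at hS hS'
  have hR := (lifts_transvection hB he hv).mul (hS.lifts_one one_ne_zero)
  have hR' := (lifts_transvection hB he hv').mul (hS'.lifts_one one_ne_zero)
  rw [mul_one] at hR hR'
  have hZ : IsSymbol e 2 ((transvection hB 1 v' * transvection hB 2 W' *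
      (transvection hB 1 v * transvection hB 2 W))⁻¹ *
      (transvection hB 1 v * transvection hB 2 W *
        (transvection hB 1 v' * transvection hB 2 W'))) (wedgeEnd (redVec e W) (redVec e W')) := by
    have hZ := (hS.inv one_ne_zero).commutator one_ne_zero one_ne_zero (hS'.inv one_ne_zero)
    rw [sqEnd_mul_add_mul hww'] at hZ
    have hc : ∀ p q r : Sp B, (p * q)⁻¹ * (p * r) = q⁻¹ * r := fun p q r => by group
    rw [mul_mul_mul_comm_of_commute (transvection_commute hB 2 1 hWv'),
      mul_mul_mul_comm_of_commute (transvection_commute hB 1 2 hvW').symm,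
      transvection_commute hB 1 1 hvv', hc]
    have hc' : ∀ p q : Sp B, p⁻¹ * q⁻¹ * (q⁻¹ * p⁻¹)⁻¹ = (q * p)⁻¹ * (p * q) :=
      fun p q => by group
    rwa [hc'] at hZ
  obtain ⟨K, hK⟩ := exists_isSymbol e ha
  obtain ⟨K', hK'⟩ := exists_isSymbol e ha'
  have h := IsSymbol.commutator_of_lifts two_ne_zero hR hR' hZ hK hK'
  rw [Equiv.swap_inv, Equiv.swap_inv, add_conjPerm_swap (hK.mem_symEnd he two_ne_zero),
      add_conjPerm_swap (hK'.mem_symEnd he two_ne_zero), add_right_comm] at h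
  exact (permStable_layer hG).altEnd_le_of_commutator hd
    (containsDisjoint_layer_one (altEnd_le_layer_zero hd hB he hG)) hij hik hil hjk hjl hkl hww'
    ⟨_, mul_mem (inv_mem (mul_mem haG' haG)) (mul_mem haG haG'), h⟩

end LowLayers

/-! ### The third layer -/

section ThirdLayer

variable {d : ℕ} {V : Type*} [AddCommGroup V] [Module ℤ_[2] V] [Module.Free ℤ_[2] V]
  {B : V →ₗ[ℤ_[2]] V →ₗ[ℤ_[2]] ℤ_[2]} {e : Red V 2 ≃+ StdSpace d} {G : Subgroup (Sp B)}

theorem wedgeEnd_mul_self {x y : StdSpace d} (h : stdForm d x y = 1) :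
    wedgeEnd x y * wedgeEnd x y = wedgeEnd x y := by
  refine LinearMap.ext fun z => ?_
  rw [Module.End.mul_apply, wedgeEnd_apply _ _ z, map_add, map_smul, map_smul, wedgeEnd_apply,
    wedgeEnd_apply, stdForm_self, stdForm_self, stdForm_comm y x, h]
  simp only [zero_smul, one_smul, add_zero, zero_add]

/-- If `a = 1 + 2 A` lies in `G`, with `A` a projection modulo `2`, and the third layer of `G` is
alternating, then `⟨A v, v⟩` is divisible by `4`. -/
theorem four_dvd_of_projection
    (he : ∀ v w : V, stdForm d (redVec e v) (redVec e w) = PadicInt.toZMod (B v w))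
    (hB : ∀ v, B v v = 0)
    (hlayer : layer e G 2 ≤ altEnd d) {a : Sp B} (ha : a ∈ G)
    {X : Module.End (ZMod 2) (StdSpace d)} (hX : IsSymbol e 1 a X) (halt : X ∈ altEnd d)
    (hXX : X * X = X) {v w : V} (hvw : a.1 v = v + (2 : ℤ_[2]) • w) :
    ∃ c, B w v = 4 * c := by
  have hsq := hX.sq_one
  rw [hXX, add_self_end, isSymbol_zero_iff] at hsq
  obtain ⟨Y, hY⟩ := exists_isSymbol e hsq
  have hYalt := hlayer ⟨_, mul_mem ha ha, hY⟩
  obtain ⟨p, hp, hp'⟩ := hY v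
  obtain ⟨u, hu, hu'⟩ := hX w
  rw [pow_one] at hu
  have h1 : w + u = (2 : ℤ_[2]) • p := by
    refine two_pow_smul_injective 2 (add_left_cancel (a := v) ?_)
    rw [smul_smul, show (2 ^ 2 * 2 : ℤ_[2]) = 2 ^ 3 by norm_num, ← hp, mul_val_apply, hvw, map_add,
      map_smul, hvw, hu]
    module
  obtain ⟨r, hr⟩ := toZMod_eq_zero.1 ((he p v).symm.trans (by rw [hp']; exact hYalt _))
  obtain ⟨s, hs⟩ := toZMod_eq_zero.1 ((he u w).symm.trans (by rw [hu']; exact halt _))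
  -- Invariance of the pairing gives B(u, v) = -2 B(u, w), divisible by 4 because X is alternating.
  -- As B(p, v) is even and w + u = 2p, so is B(w, v).
  have h2 := a.2 w v
  rw [hu, hvw] at h2
  simp only [map_add, map_smul, LinearMap.add_apply, LinearMap.smul_apply, smul_eq_mul, hB, hs]
    at h2
  have h3 : (2 ^ 1 : ℤ_[2]) * (B u v + 4 * s) = 0 := by linear_combination h2
  have h4 := (mul_eq_zero.1 h3).resolve_left (two_pow_ne_zero' 1)
  have h5 := congrArg (fun x => B x v) h1
  simp only [map_add, map_smul, LinearMap.add_apply, LinearMap.smul_apply, smul_eq_mul, hr] at h5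
  exact ⟨r + s, by linear_combination h5 - h4⟩

/-- With u = v_ij, the projections u ∧ v_jk, u ∧ v_jl, u ∧ v_jm add up to another projection, so
`four_dvd_of_projection` applies to three elements 1 + 2A_r of G and to their product. Comparison
makes ⟨(A₁A₂ + A₁A₃ + A₂A₃)v, v⟩ even, but it is odd for v lifting v_ik. -/
theorem layer_two_not_le_altEnd (hd : 5 ≤ d) (hB : ∀ v, B v v = 0)
    (he : ∀ v w : V, stdForm d (redVec e v) (redVec e w) = PadicInt.toZMod (B v w))
    (halt : altEnd d ≤ layer e G 0) : ¬ layer e G 2 ≤ altEnd d := by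
  intro hlayer
  obtain ⟨i, j, hij⟩ : ∃ i j : Fin d, i ≠ j := ⟨⟨0, by omega⟩, ⟨1, by omega⟩, by simp⟩
  obtain ⟨k, hik, hjk⟩ := exists_fin_ne_two hd i j
  obtain ⟨l, hil, hjl, hkl⟩ := exists_fin_ne_three hd i j k
  obtain ⟨m, him, hjm, hkm, hlm⟩ := exists_fin_ne_four hd i j k l
  have huw : ∀ n, i ≠ n → j ≠ n → stdForm d (pairVec i j) (pairVec j n) = 1 := fun n hin hjn => by
    rw [pairVec_comm, stdForm_pairVec_of_common hij.symm hjn hin]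
  have huw1 := huw k hik hjk
  have huw2 := huw l hil hjl
  have huw3 := huw m him hjm
  obtain ⟨a1, ha1, hX1⟩ := halt (wedgeEnd_mem_altEnd (pairVec i j) (pairVec j k))
  obtain ⟨a2, ha2, hX2⟩ := halt (wedgeEnd_mem_altEnd (pairVec i j) (pairVec j l))
  obtain ⟨a3, ha3, hX3⟩ := halt (wedgeEnd_mem_altEnd (pairVec i j) (pairVec j m))
  have hX4 := hX1.mul one_ne_zero (hX2.mul one_ne_zero hX3)
  rw [← wedgeEnd_add_right, ← wedgeEnd_add_right] at hX4
  obtain ⟨v, hv⟩ := redVec_surjective (e := e) (pairVec i k)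
  obtain ⟨p1, hp1, hp1'⟩ := hX1 v
  obtain ⟨p2, hp2, hp2'⟩ := hX2 v
  obtain ⟨p3, hp3, hp3'⟩ := hX3 v
  obtain ⟨p4, hp4, -⟩ := hX4 v
  obtain ⟨q12, hq12, hq12'⟩ := hX1 p2
  obtain ⟨q13, hq13, hq13'⟩ := hX1 p3
  obtain ⟨q23, hq23, hq23'⟩ := hX2 p3
  obtain ⟨r, hr, -⟩ := hX1 q23
  simp only [zero_add, pow_one] at hp1 hp2 hp3 hp4 hq12 hq13 hq23 hr
  obtain ⟨c1, hc1⟩ := four_dvd_of_projection he hB hlayer ha1 hX1 (wedgeEnd_mem_altEnd _ _)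
    (wedgeEnd_mul_self huw1) hp1
  obtain ⟨c2, hc2⟩ := four_dvd_of_projection he hB hlayer ha2 hX2 (wedgeEnd_mem_altEnd _ _)
    (wedgeEnd_mul_self huw2) hp2
  obtain ⟨c3, hc3⟩ := four_dvd_of_projection he hB hlayer ha3 hX3 (wedgeEnd_mem_altEnd _ _)
    (wedgeEnd_mul_self huw3) hp3
  obtain ⟨c4, hc4⟩ := four_dvd_of_projection he hB hlayer (mul_mem ha1 (mul_mem ha2 ha3)) hX4
    (wedgeEnd_mem_altEnd _ _) (wedgeEnd_mul_self (by
      rw [map_add, map_add, huw1, huw2, huw3]; rfl)) hp4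
  have hp : p4 = p1 + p2 + p3 + (2 : ℤ_[2]) • (q12 + q13 + q23 + (2 : ℤ_[2]) • r) := by
    refine two_pow_smul_injective 1 (add_left_cancel (a := v) ?_)
    rw [pow_one, ← hp4, mul_val_apply, mul_val_apply]
    simp only [hp3, hp2, hp1, hq23, hq13, hq12, hr, map_add, map_smul]
    module
  have h1 := congrArg (fun x => B x v) hp
  simp only [map_add, map_smul, LinearMap.add_apply, LinearMap.smul_apply, smul_eq_mul, hc1, hc2,
    hc3, hc4] at h1
  have h2 : (2 ^ 1 : ℤ_[2]) * (B q12 v + B q13 v + B q23 v) =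
      2 ^ 1 * (2 * (c4 - c1 - c2 - c3 - B r v)) := by linear_combination -h1
  have h3 := mul_left_cancel₀ (two_pow_ne_zero' 1) h2
  have h4 := toZMod_eq_zero.2 ⟨_, h3⟩
  rw [map_add, map_add, ← he, ← he, ← he, hq12', hq13', hq23', hp2', hp3', hv] at h4
  have hw : ∀ {a b}, j ≠ a → j ≠ b → a ≠ b → stdForm d (pairVec j a) (pairVec j b) = 1 :=
    fun ha hb hab => stdForm_pairVec_of_common ha hb hab
  have hxu : stdForm d (pairVec i k) (pairVec i j) = 1 :=
    stdForm_pairVec_of_common hik hij hjk.symm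
  have hxw : ∀ {n}, i ≠ n → j ≠ n → k ≠ n → stdForm d (pairVec i k) (pairVec j n) = 0 :=
    fun hin hjn hkn => stdForm_pairVec_of_disjoint hij hin hjk.symm hkn
  have hwx : stdForm d (pairVec j k) (pairVec i k) = 1 := by
    rw [pairVec_comm j, pairVec_comm i, stdForm_pairVec_of_common hjk.symm hik.symm hij.symm]
  simp only [wedgeEnd_apply, hxu, hxw hil hjl hkl, hxw him hjm hkm, one_smul, zero_smul, add_zero,
    stdForm_comm (pairVec j _) (pairVec i j), huw2, huw3, hw hjl hjk hkl.symm,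
    hw hjm hjk hkm.symm, hw hjm hjl hlm.symm, map_add, LinearMap.add_apply, hwx,
    stdForm_comm (pairVec j l) (pairVec i k), stdForm_comm (pairVec i j) (pairVec i k)] at h4
  revert h4
  decide

end ThirdLayer

/-! ### Conjugacy -/

section Conjugacy

variable {d : ℕ} {V : Type*} [AddCommGroup V] [Module ℤ_[2] V]
  {B : V →ₗ[ℤ_[2]] V →ₗ[ℤ_[2]] ℤ_[2]} {e : Red V 2 ≃+ StdSpace d} {G H : Subgroup (Sp B)} {n : ℕ}

instance (m : ℕ) : (Gam B m).Normal := MonoidHom.normal_ker _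

/-- `g⁻¹ h` lies in `Γ(2 ^ (n + 1))` for some `h ∈ H`, and the diagonal of its symbol is `w`. -/
def IsCrossDiag (e : Red V 2 ≃+ StdSpace d) (H : Subgroup (Sp B)) (n : ℕ) (g : Sp B)
    (w : StdSpace d) : Prop :=
  ∃ h ∈ H, ∃ X, IsSymbol e (n + 1) (g⁻¹ * h) X ∧ ∀ x, stdForm d (X x) x = stdForm d x w

theorem eq_of_stdForm_eq {w w' : StdSpace d} (h : ∀ x, stdForm d x w = stdForm d x w') :
    w = w' := by
  rw [← sub_eq_zero]
  refine stdForm_nondegenerate _ fun y => ?_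
  rw [stdForm_comm, map_sub, h, sub_self]

theorem stdForm_conjPerm (σ : Equiv.Perm (Fin d)) {X : Module.End (ZMod 2) (StdSpace d)}
    {w : StdSpace d} (hw : ∀ x, stdForm d (X x) x = stdForm d x w) (x : StdSpace d) :
    stdForm d (conjPerm σ X x) x = stdForm d x (permStd σ w) := by
  rw [conjPerm_apply, stdForm_permStd_left, hw, stdForm_permStd_left, inv_inv]

/-- This follows from (gg')⁻¹hh' = g'⁻¹(g⁻¹h)g' · g'⁻¹h'. -/
theorem IsCrossDiag.mul {g g' : Sp B} {w w' : StdSpace d} {τ : Equiv.Perm (Fin d)}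
    (hw : IsCrossDiag e H n g w) (hw' : IsCrossDiag e H n g' w') (hτ : Lifts e g' τ) :
    IsCrossDiag e H n (g * g') (permStd τ⁻¹ w + w') := by
  obtain ⟨h, hh, X, hX, hXw⟩ := hw
  obtain ⟨h', hh', X', hX', hXw'⟩ := hw'
  refine ⟨h * h', mul_mem hh hh', conjPerm τ⁻¹ X + X', ?_, fun x => ?_⟩
  · convert (hX.conj hτ.inv).mul n.succ_ne_zero hX' using 1
    group
  · rw [LinearMap.add_apply, map_add, LinearMap.add_apply, hXw', stdForm_conjPerm _ hXw, map_add]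

theorem layer_map_conj {u : Sp B} (hu : u ∈ Gam B 2) (G : Subgroup (Sp B)) :
    layer e (G.map (MulAut.conj u).toMonoidHom) n = layer e G n := by
  have hu1 : Lifts e u 1 := lifts_one_iff.2 hu
  ext X
  constructor
  · rintro ⟨_, ⟨a, ha, rfl⟩, hX⟩
    refine ⟨a, ha, ?_⟩
    have h := hX.conj hu1.inv
    rw [inv_one, conjPerm_one] at h
    convert h using 1
    simp [mul_assoc]
  · rintro ⟨a, ha, hX⟩
    refine ⟨_, ⟨a, ha, rfl⟩, ?_⟩
    have h := hX.conj hu1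
    rwa [conjPerm_one] at h

theorem Lifts.conj {u g : Sp B} {σ : Equiv.Perm (Fin d)} (hg : Lifts e g σ) (hu : u ∈ Gam B 2) :
    Lifts e (u * g * u⁻¹) σ := by
  have hu1 : Lifts e u 1 := lifts_one_iff.2 hu
  have h := (hu1.mul hg).mul hu1.inv
  rwa [inv_one, one_mul, mul_one] at h

variable [Module.Free ℤ_[2] V]

theorem isCrossDiag_of_mem_layer {g : Sp B} (hg : g ∈ G) {X : Module.End (ZMod 2) (StdSpace d)}
    (hX : IsSymbol e (n + 1) g X) (hlayer : layer e G n ≤ altEnd d) : IsCrossDiag e H n g 0 := by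
  refine ⟨1, one_mem _, X, by rw [mul_one]; exact hX.inv n.succ_ne_zero, fun x => ?_⟩
  rw [map_zero]
  exact hlayer ⟨g, hg, hX⟩ x

/-- Two choices of h differ by an element of H whose symbol lies in layer n, hence is alternating.
-/
theorem IsCrossDiag.unique {g : Sp B} {w w' : StdSpace d} (hH : layer e H n ≤ altEnd d)
    (hw : IsCrossDiag e H n g w) (hw' : IsCrossDiag e H n g w') : w = w' := by
  obtain ⟨h, hh, X, hX, hXw⟩ := hw
  obtain ⟨h', hh', X', hX', hXw'⟩ := hw'
  refine eq_of_stdForm_eq fun x => ?_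
  have h1 := (hX.inv n.succ_ne_zero).mul n.succ_ne_zero hX'
  have h2 := hH ⟨h⁻¹ * h', mul_mem (inv_mem hh) hh', by convert h1 using 1; group⟩ x
  rw [LinearMap.add_apply, map_add, LinearMap.add_apply, hXw, hXw'] at h2
  exact CharTwo.add_eq_zero.1 h2

theorem exists_isCrossDiag
    (he : ∀ v w : V, stdForm d (redVec e v) (redVec e w) = PadicInt.toZMod (B v w))
    (hGH : ∀ g ∈ G, ∃ h ∈ H, g⁻¹ * h ∈ Gam B (2 ^ (n + 1))) {g : Sp B} (hg : g ∈ G) :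
    ∃ w, IsCrossDiag e H n g w := by
  obtain ⟨h, hh, hgh⟩ := hGH g hg
  obtain ⟨X, hX⟩ := exists_isSymbol e hgh
  obtain ⟨w, hw⟩ := exists_diag (hX.mem_symEnd he n.succ_ne_zero)
  exact ⟨w, h, hh, X, hX, hw⟩

/-- One step in the construction of an element conjugating `G` into `H`. -/
theorem exists_conj_step (hd : 5 ≤ d) (hodd : Odd d) (hB : ∀ v, B v v = 0)
    (he : ∀ v w : V, stdForm d (redVec e v) (redVec e w) = PadicInt.toZMod (B v w))
    (hGl : ∀ g ∈ G, ∃ σ, Lifts e g σ) (hGs : ∀ σ, ∃ g ∈ G, Lifts e g σ)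
    (hGH : ∀ g ∈ G, ∃ h ∈ H, g⁻¹ * h ∈ Gam B (2 ^ (n + 1))) (hH : layer e H n = altEnd d)
    (hvan : ∀ g ∈ G, Lifts e g 1 → ∀ w, IsCrossDiag e H n g w → w = 0) :
    ∃ u ∈ Gam B (2 ^ (n + 1)), ∀ g ∈ G, ∃ h ∈ H, (u * g * u⁻¹)⁻¹ * h ∈ Gam B (2 ^ (n + 2)) := by
  -- As the diagonal vanishes on the elements of G acting trivially modulo 2, it depends on the
  -- permutation alone.
  have hsame : ∀ g ∈ G, ∀ g' ∈ G, ∀ σ, Lifts e g σ → Lifts e g' σ → ∀ w, IsCrossDiag e H n g w →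
      IsCrossDiag e H n g' w := by
    intro g hg g' hg' σ hσ hσ' w hw
    have hk := hσ.inv.mul hσ'
    rw [inv_mul_cancel] at hk
    have hkG := mul_mem (inv_mem hg) hg'
    obtain ⟨w0, hw0⟩ := exists_isCrossDiag he hGH hkG
    have h := hw.mul hw0 hk
    rwa [mul_inv_cancel_left, hvan _ hkG hk w0 hw0, inv_one, permStd_one, add_zero] at h
  choose s hsG hsσ using hGs
  choose ψ hψ using fun σ => exists_isCrossDiag (H := H) (n := n) he hGH (hsG σ)
  obtain ⟨x, hx⟩ := exists_of_crossedHom hd hodd ψ fun σ τ =>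
    (hψ (σ * τ)).unique hH.le (hsame _ (mul_mem (hsG σ) (hsG τ)) _ (hsG _) _
      ((hsσ σ).mul (hsσ τ)) (hsσ _) _ ((hψ σ).mul (hψ τ) (hsσ τ)))
  obtain ⟨y, rfl⟩ := redVec_surjective (e := e) x
  have hu := isSymbol_transvection hB he (n + 1) y
  refine ⟨_, hu.mem_Gam, fun g hg => ?_⟩
  obtain ⟨σ, hσ⟩ := hGl g hg
  obtain ⟨h, hh, X, hX, hXw⟩ := hsame _ (hsG σ) g hg σ (hsσ σ) hσ _ (hψ σ)
  -- Here (ugu⁻¹)⁻¹h = u · (g⁻¹u⁻¹g) · g⁻¹h. The first two factors have diagonal x + σ⁻¹x = ψ(σ),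
  -- cancelling that of X, and the alternating remainder is removed by an element of H.
  have h1 := (hu.mul n.succ_ne_zero ((hu.inv n.succ_ne_zero).conj hσ.inv)).mul n.succ_ne_zero hX
  have halt : sqEnd (redVec e y) + conjPerm σ⁻¹ (sqEnd (redVec e y)) + X ∈ altEnd d := by
    intro z
    rw [LinearMap.add_apply, LinearMap.add_apply, map_add, map_add, LinearMap.add_apply,
      LinearMap.add_apply, stdForm_conjPerm _ (stdForm_sqEnd _), stdForm_sqEnd, hXw, hx, ← map_add,
      ← map_add, add_comm (redVec e y), add_self_std, map_zero]
  rw [← hH] at halt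
  obtain ⟨h', hh', hX'⟩ := halt
  refine ⟨h * h'⁻¹, mul_mem hh (inv_mem hh'), ?_⟩
  rw [← isSymbol_zero_iff (e := e)]
  convert h1.mul n.succ_ne_zero (hX'.inv n.succ_ne_zero) using 1
  · group
  · rw [add_self_end]

theorem crossDiag_zero_of_lifts_one (hG : layer e G 0 ≤ altEnd d) (hH : layer e H 0 ≤ altEnd d)
    {g : Sp B} (hg : g ∈ G) (hg1 : Lifts e g 1) {w : StdSpace d} (hw : IsCrossDiag e H 0 g w) :
    w = 0 := by
  obtain ⟨X, hX⟩ := exists_isSymbol (n := 1) e (lifts_one_iff.1 hg1)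
  exact hw.unique hH (isCrossDiag_of_mem_layer hg hX hG)

/-- On G ∩ Γ(2) the diagonal is a homomorphism that kills G ∩ Γ(4), since layer 1 is alternating. It
induces an equivariant map from layer 0, which is `altEnd d`, to V̄; the relation R is its graph. -/
theorem crossDiag_one_of_lifts_one (hd : 5 ≤ d)
    (he : ∀ v w : V, stdForm d (redVec e v) (redVec e w) = PadicInt.toZMod (B v w))
    (hGs : ∀ σ, ∃ g ∈ G, Lifts e g σ)
    (hGH : ∀ g ∈ G, ∃ h ∈ H, g⁻¹ * h ∈ Gam B (2 ^ 2))
    (hG0 : layer e G 0 = altEnd d) (hG1 : layer e G 1 ≤ altEnd d) (hH : layer e H 1 ≤ altEnd d)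
    {g : Sp B} (hg : g ∈ G) (hg1 : Lifts e g 1) {w : StdSpace d} (hw : IsCrossDiag e H 1 g w) :
    w = 0 := by
  have hone : IsCrossDiag e H 1 1 0 := isCrossDiag_of_mem_layer (one_mem G) isSymbol_one hG1
  let R : AddSubgroup (Module.End (ZMod 2) (StdSpace d) × StdSpace d) :=
    { carrier := {p | ∃ a ∈ G, IsSymbol e 1 a p.1 ∧ IsCrossDiag e H 1 a p.2}
      add_mem' := by
        rintro ⟨X, x⟩ ⟨Y, y⟩ ⟨a, ha, hX, hx⟩ ⟨b, hb, hY, hy⟩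
        refine ⟨a * b, mul_mem ha hb, hX.mul one_ne_zero hY, ?_⟩
        have := hx.mul hy (hY.lifts_one one_ne_zero)
        rwa [inv_one, permStd_one] at this
      zero_mem' := ⟨1, one_mem _, isSymbol_one, hone⟩
      neg_mem' := by
        rintro ⟨X, x⟩ h
        rwa [Prod.neg_mk, neg_end, neg_std] }
  obtain ⟨Y, hY⟩ := exists_isSymbol (n := 1) e (lifts_one_iff.1 hg1)
  refine eq_zero_of_equivariant hd R ?_ ?_ ?_ (hG0.le ⟨g, hg, hY⟩) ⟨g, hg, hY, hw⟩
  · rintro σ X y ⟨a, ha, hX, hy⟩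
    obtain ⟨s, hs, hsσ⟩ := hGs σ
    obtain ⟨z, hz⟩ := exists_isCrossDiag (n := 1) he hGH hs
    obtain ⟨z', hz'⟩ := exists_isCrossDiag (n := 1) he hGH (inv_mem hs)
    refine ⟨s * a * s⁻¹, mul_mem (mul_mem hs ha) (inv_mem hs), hX.conj hsσ, ?_⟩
    have h1 := hz.mul hz' hsσ.inv
    rw [mul_inv_cancel] at h1
    have h2 := h1.unique hH hone
    have h3 := (hz.mul hy (hX.lifts_one one_ne_zero)).mul hz' hsσ.inv
    rw [inv_inv] at h2 h3
    rwa [inv_one, permStd_one, map_add, add_right_comm, h2, zero_add] at h3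
  · rintro y ⟨a, ha, hX, hy⟩
    obtain ⟨X', hX'⟩ := exists_isSymbol e (isSymbol_zero_iff.1 hX)
    exact hy.unique hH (isCrossDiag_of_mem_layer ha hX' hG1)
  · rintro X hX
    rw [← hG0] at hX
    obtain ⟨a, ha, haX⟩ := hX
    obtain ⟨y, hy⟩ := exists_isCrossDiag (n := 1) he hGH ha
    exact ⟨y, a, ha, haX, hy⟩

theorem exists_conj_eq (hd : 5 ≤ d) (hodd : Odd d) (hB : ∀ v, B v v = 0)
    (he : ∀ v w : V, stdForm d (redVec e v) (redVec e w) = PadicInt.toZMod (B v w))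
    (hGl : ∀ g ∈ G, ∃ σ, Lifts e g σ) (hGs : ∀ σ, ∃ g ∈ G, Lifts e g σ)
    (hHl : ∀ g ∈ H, ∃ σ, Lifts e g σ) (hHs : ∀ σ, ∃ g ∈ H, Lifts e g σ)
    (hG0 : layer e G 0 = altEnd d) (hG1 : layer e G 1 = altEnd d)
    (hH0 : layer e H 0 = altEnd d) (hH1 : layer e H 1 = altEnd d)
    (hG8 : Gam B (2 ^ 3) ≤ G) (hH8 : Gam B (2 ^ 3) ≤ H) :
    ∃ u ∈ Gam B 2, H = G.map (MulAut.conj u).toMonoidHom := by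
  have hGH : ∀ g ∈ G, ∃ h ∈ H, g⁻¹ * h ∈ Gam B (2 ^ (0 + 1)) := by
    intro g hg
    obtain ⟨σ, hσ⟩ := hGl g hg
    obtain ⟨h, hh, hhσ⟩ := hHs σ
    have := hσ.inv.mul hhσ
    rw [inv_mul_cancel, lifts_one_iff] at this
    exact ⟨h, hh, this⟩
  obtain ⟨u, hu, huG⟩ := exists_conj_step (n := 0) hd hodd hB he hGl hGs hGH hH0
    fun g hg hg1 w hw => crossDiag_zero_of_lifts_one hG0.le hH0.le hg hg1 hw
  change u ∈ Gam B 2 at hu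
  obtain ⟨u', hu', huG'⟩ := exists_conj_step (n := 1) (G := G.map (MulAut.conj u).toMonoidHom)
    (H := H) hd hodd hB he
    (by
      rintro _ ⟨g, hg, rfl⟩
      exact (hGl g hg).imp fun σ hσ => hσ.conj hu)
    (fun σ => by
      obtain ⟨g, hg, hσ⟩ := hGs σ
      exact ⟨_, ⟨g, hg, rfl⟩, hσ.conj hu⟩)
    (by
      rintro _ ⟨g, hg, rfl⟩
      exact huG g hg) hH1
    (fun g hg hg1 w hw => crossDiag_one_of_lifts_one hd he
      (fun σ => by
        obtain ⟨g, hg, hσ⟩ := hGs σ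
        exact ⟨_, ⟨g, hg, rfl⟩, hσ.conj hu⟩)
      (by
        rintro _ ⟨g, hg, rfl⟩
        exact huG g hg)
      (by rw [layer_map_conj hu, hG0]) (by rw [layer_map_conj hu, hG1]) hH1.le hg hg1 hw)
  have hu2 : u' * u ∈ Gam B 2 := mul_mem (Gam_antitone (m := 1) (by omega) hu') hu
  have hle : G.map (MulAut.conj (u' * u)).toMonoidHom ≤ H := by
    rintro _ ⟨g, hg, rfl⟩
    obtain ⟨h, hh, hgh⟩ := huG' _ ⟨g, hg, rfl⟩
    have h1 := mul_mem hh (inv_mem (hH8 hgh))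
    convert h1 using 1
    simp [mul_assoc]
  refine ⟨u' * u, hu2, le_antisymm ?_ hle⟩
  have h8 : Gam B (2 ^ 3) ≤ G.map (MulAut.conj (u' * u)).toMonoidHom := by
    intro a ha
    refine ⟨(u' * u)⁻¹ * a * (u' * u)⁻¹⁻¹, hG8 (Subgroup.Normal.conj_mem inferInstance a ha _), ?_⟩
    simp [mul_assoc]
  have hK0 := (layer_map_conj (e := e) (n := 0) hu2 G).trans hG0
  have hK1 := (layer_map_conj (e := e) (n := 1) hu2 G).trans hG1
  set K := G.map (MulAut.conj (u' * u)).toMonoidHom with hK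
  -- For the reverse inclusion, an element of H is approximated from K through two layers, which
  -- agree for K and H, and Γ(8) absorbs the rest.
  have hred : ∀ (m : ℕ), layer e H m = altEnd d → layer e K m = altEnd d → ∀ h ∈ H,
      h ∈ Gam B (2 ^ (m + 1)) → ∃ k ∈ K, k⁻¹ * h ∈ Gam B (2 ^ (m + 2)) := by
    intro m hHm hKm h hh hm
    obtain ⟨X, hX⟩ := exists_isSymbol e hm
    have hXm : X ∈ layer e H m := ⟨h, hh, hX⟩
    rw [hHm, ← hKm] at hXm
    obtain ⟨k, hk, hkX⟩ := hXm
    exact ⟨k, hk, hkX.mem_Gam_succ_of_same m.succ_ne_zero hX⟩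
  intro h hh
  obtain ⟨σ, hσ⟩ := hHl h hh
  obtain ⟨g, hg, hgσ⟩ := hGs σ
  have hkG : u' * u * g * (u' * u)⁻¹ ∈ K := ⟨g, hg, rfl⟩
  have h1 := (hgσ.conj hu2).inv.mul hσ
  rw [inv_mul_cancel, lifts_one_iff] at h1
  obtain ⟨k, hk, hk2⟩ := hred 0 hH0 hK0 _ (mul_mem (inv_mem (hle hkG)) hh) h1
  obtain ⟨k', hk', hk3⟩ := hred 1 hH1 hK1 _ (mul_mem (inv_mem (hle hk))
    (mul_mem (inv_mem (hle hkG)) hh)) hk2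
  have h4 := mul_mem hkG (mul_mem hk (mul_mem hk' (h8 hk3)))
  rwa [mul_inv_cancel_left, mul_inv_cancel_left, mul_inv_cancel_left] at h4

end Conjugacy

/-! ### Orders -/

section Orders

variable {d : ℕ}

/-- If ρ moves i, some j and m make {ρ i, ρ j} disjoint from {i, m} while v_ij meets v_im in one
index, so ρ cannot fix v_ij. -/
theorem permStd_injective (hd : 5 ≤ d) {σ τ : Equiv.Perm (Fin d)}
    (h : ∀ x : StdSpace d, permStd σ x = permStd τ x) : σ = τ := by
  have h1 : ∀ i j, pairVec ((τ⁻¹ * σ) i) ((τ⁻¹ * σ) j) = pairVec i j := by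
    intro i j
    rw [← permStd_pairVec, permStd_mul, h, permStd_inv_apply]
  suffices τ⁻¹ * σ = 1 from (inv_mul_eq_one.1 this).symm
  generalize τ⁻¹ * σ = ρ at h1
  refine Equiv.ext fun i => ?_
  by_contra hi
  rw [Equiv.Perm.one_apply] at hi
  obtain ⟨j, hij, hj⟩ := exists_fin_ne_two hd i (ρ⁻¹ i)
  have hj' : ρ j ≠ i := fun h => hj (Equiv.Perm.inv_eq_iff_eq.2 h.symm)
  obtain ⟨m, him, hjm, h1m, h2m⟩ := exists_fin_ne_four hd i j (ρ i) (ρ j)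
  have h2 := stdForm_pairVec_of_common hij him hjm
  rw [← h1 i j, stdForm_pairVec_of_disjoint hi h1m hj' h2m] at h2
  exact zero_ne_one h2

theorem finrank_stdSpace (hd : Odd d) : Module.finrank (ZMod 2) (StdSpace d) = d - 1 := by
  let f : (Fin d → ZMod 2) →ₗ[ZMod 2] ZMod 2 := ∑ i, LinearMap.proj i
  have hf : ∀ w, f w = ∑ i, w i := fun w => by simp [f, LinearMap.sum_apply]
  have hker : LinearMap.ker f = sumZero d := by
    ext w
    rw [LinearMap.mem_ker, hf]
    rfl
  have hsurj : Function.Surjective f := by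
    intro c
    obtain ⟨k, hk⟩ := hd
    exact ⟨Pi.single ⟨0, by omega⟩ c, by rw [hf, Finset.sum_pi_single']; simp⟩
  have h1 := f.finrank_range_add_finrank_ker
  rw [LinearMap.range_eq_top.2 hsurj, finrank_top, hker, Module.finrank_self,
    Module.finrank_fin_fun] at h1
  have h2 := (onesLine d).finrank_quotient_add_finrank
  rw [onesLine_eq_bot_of_odd hd, finrank_bot] at h2
  have h3 : Module.finrank (ZMod 2) (StdSpace d) = Module.finrank (ZMod 2) (sumZero d) := by
    rw [← h2, ← onesLine_eq_bot_of_odd hd]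
    rfl
  omega

variable {V : Type*} [AddCommGroup V] [Module ℤ_[2] V]
  {B : V →ₗ[ℤ_[2]] V →ₗ[ℤ_[2]] ℤ_[2]} {e : Red V 2 ≃+ StdSpace d} {G : Subgroup (Sp B)}

theorem card_map_redSp_two (hd : 5 ≤ d) (hGl : ∀ g ∈ G, ∃ σ, Lifts e g σ)
    (hGs : ∀ σ, ∃ g ∈ G, Lifts e g σ) : Nat.card (G.map (redSp B 2)) = Nat.factorial d := by
  choose s hsG hsσ using hGs
  let f : Equiv.Perm (Fin d) → G.map (redSp B 2) := fun σ => ⟨redSp B 2 (s σ), s σ, hsG σ, rfl⟩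
  have hf : Function.Bijective f := by
    constructor
    · intro σ τ h
      have h1 := (hsσ σ).of_redSp_eq (congrArg Subtype.val h)
      refine permStd_injective hd fun x => ?_
      obtain ⟨v, rfl⟩ := redVec_surjective (e := e) x
      rw [← h1, hsσ τ]
    · rintro ⟨_, a, ha, rfl⟩
      obtain ⟨σ, hσ⟩ := hGl a ha
      refine ⟨σ, Subtype.ext (redSp_eq_iff.2 ?_)⟩
      have := (hsσ σ).inv.mul hσ
      rwa [inv_mul_cancel, lifts_one_iff] at this
  rw [← Nat.card_eq_of_bijective f hf, Nat.card_perm, Nat.card_eq_fintype_card, Fintype.card_fin]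

/-- The symbol identifies the quotient of G ∩ Γ(2^(n+1)) by G ∩ Γ(2^(n+2)) with the layer. -/
theorem relIndex_Gam_eq_card_layer [Module.Free ℤ_[2] V] (n : ℕ) :
    (Gam B (2 ^ (n + 2))).relIndex (Gam B (2 ^ (n + 1)) ⊓ G) = Nat.card (layer e G n) := by
  unfold Gam
  rw [Subgroup.relIndex_ker]
  choose s hsG hs using fun X : layer e G n => X.2
  let f : layer e G n → (Gam B (2 ^ (n + 1)) ⊓ G).map (redSp B (2 ^ (n + 2))) := fun X =>
    ⟨redSp B _ (s X), s X, ⟨(hs X).mem_Gam, hsG X⟩, rfl⟩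
  have hf : Function.Bijective f := by
    constructor
    · intro X Y h
      have h1 := redSp_eq_iff.1 (congrArg Subtype.val h)
      exact Subtype.ext (((hs X).of_mul_mem_Gam n.succ_ne_zero h1).unique (hs Y))
    · rintro ⟨_, a, ⟨haΓ, haG⟩, rfl⟩
      obtain ⟨X, hX⟩ := exists_isSymbol e haΓ
      exact ⟨⟨X, a, haG, hX⟩, Subtype.ext (redSp_eq_iff.2
        ((hs _).mem_Gam_succ_of_same n.succ_ne_zero hX))⟩
  exact (Nat.card_eq_of_bijective f hf).symm

theorem relIndex_Gam_succ [Module.Free ℤ_[2] V] (n : ℕ) :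
    (Gam B (2 ^ (n + 2))).relIndex G =
      Nat.card (layer e G n) * (Gam B (2 ^ (n + 1))).relIndex G := by
  rw [← relIndex_Gam_eq_card_layer (e := e), Subgroup.relIndex_inf_mul_relIndex,
    inf_eq_left.2 (Gam_antitone (Nat.le_succ _))]

theorem card_map_redSp_eight [Module.Free ℤ_[2] V] (hd : 5 ≤ d) (hodd : Odd d) {g : ℕ}
    (hg : d = 2 * g + 1) (hGl : ∀ g ∈ G, ∃ σ, Lifts e g σ)
    (hGs : ∀ σ, ∃ g ∈ G, Lifts e g σ) (h0 : layer e G 0 = altEnd d)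
    (h1 : layer e G 1 = altEnd d) :
    Nat.card (G.map (redSp B 8)) = Nat.factorial d * 2 ^ (4 * g ^ 2 - 2 * g) := by
  have h8 : Nat.card (G.map (redSp B 8)) = (Gam B (2 ^ (1 + 2))).relIndex G :=
    (Subgroup.relIndex_ker _ _).symm
  have h2 : Nat.card (G.map (redSp B 2)) = (Gam B (2 ^ (0 + 1))).relIndex G :=
    (Subgroup.relIndex_ker _ _).symm
  rw [h8, relIndex_Gam_succ (e := e), relIndex_Gam_succ (e := e) 0, ← h2,
    card_map_redSp_two hd hGl hGs, h0, h1, card_altEnd, finrank_stdSpace hodd, ← mul_assoc,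
    ← pow_add, mul_comm]
  congr 2
  have hc : (d - 1).choose 2 = g * (2 * g - 1) := by
    rw [hg, Nat.add_sub_cancel, Nat.choose_two_right, mul_assoc, Nat.mul_div_cancel_left _ two_pos]
  rw [hc]
  zify [show 1 ≤ 2 * g by omega, show 2 * g ≤ 4 * g ^ 2 by nlinarith]
  ring

end Orders

/-! ### Assembly of the main theorem -/

section Main

variable {d : ℕ} {V : Type*} [AddCommGroup V] [Module ℤ_[2] V] [Module.Free ℤ_[2] V]
  {B : V →ₗ[ℤ_[2]] V →ₗ[ℤ_[2]] ℤ_[2]} {e : Red V 2 ≃+ StdSpace d} {G : Subgroup (Sp B)}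

theorem Gam_two_le (hd : 5 ≤ d)
    (he : ∀ v w : V, stdForm d (redVec e v) (redVec e w) = PadicInt.toZMod (B v w))
    (hGs : ∀ σ, ∃ g ∈ G, Lifts e g σ) (hG : IsClosed[twoAdic B] (G : Set (Sp B)))
    (h : symEnd d ≤ layer e G 0) : Gam B 2 ≤ G := by
  refine Gam_le_of_layers (n := 0) he hG fun m _ => ?_
  rcases Nat.eq_zero_or_pos m with rfl | hm
  · exact h
  · exact (symEnd_le_layer_one hd hGs h).trans (layer_le_layer one_ne_zero hm)

/-- The layers of a closed subgroup which does not contain `Γ(4)`. -/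
theorem layers_of_not_Gam_four_le (hd : 5 ≤ d) (hodd : Odd d) (hB : ∀ v, B v v = 0)
    (he : ∀ v w : V, stdForm d (redVec e v) (redVec e w) = PadicInt.toZMod (B v w))
    (hGs : ∀ σ, ∃ g ∈ G, Lifts e g σ) (hG : IsClosed[twoAdic B] (G : Set (Sp B)))
    (hG4 : ¬ Gam B (2 ^ 2) ≤ G) :
    layer e G 0 = altEnd d ∧ layer e G 1 = altEnd d ∧ Gam B (2 ^ 3) ≤ G := by
  have halt0 := altEnd_le_layer_zero hd hB he hGs
  have h0 : layer e G 0 ≤ altEnd d := by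
    by_contra hcon
    have h := (permStable_layer hGs).symEnd_le_of_not_altEnd (layer_le_symEnd he) halt0 hcon
    exact hG4 ((Gam_antitone (m := 1) (by omega)).trans (Gam_two_le hd he hGs hG h))
  have halt1 := altEnd_le_layer_one hd hodd hB he hGs h0
  have h1 : layer e G 1 ≤ altEnd d := by
    by_contra hcon
    have h := (permStable_layer hGs).symEnd_le_of_not_altEnd (layer_le_symEnd he) halt1 hcon
    exact hG4 (Gam_le_of_layers he hG fun m hm => h.trans (layer_le_layer one_ne_zero hm))
  have h2 := (permStable_layer hGs).symEnd_le_of_not_altEnd (layer_le_symEnd he)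
    (halt1.trans (layer_le_layer_succ one_ne_zero)) (layer_two_not_le_altEnd hd hB he halt0)
  exact ⟨le_antisymm h0 halt0, le_antisymm h1 halt1,
    Gam_le_of_layers he hG fun m hm => h2.trans (layer_le_layer two_ne_zero hm)⟩

end Main

theorem theorem1p1 (d g : ℕ) (hd : 3 ≤ d) (hg : g = (d - 1) / 2)
    {V : Type*} [AddCommGroup V] [Module ℤ_[2] V] [Module.Free ℤ_[2] V] [Module.Finite ℤ_[2] V]
    (hrank : Module.finrank ℤ_[2] V = 2 * g)
    (B : V →ₗ[ℤ_[2]] V →ₗ[ℤ_[2]] ℤ_[2]) (hB : ∀ v, B v v = 0)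
    (e : Red V 2 ≃+ StdSpace d)
    (he : ∀ v w : V, stdForm d (e ((multiples V 2).mkQ v)) (e ((multiples V 2).mkQ w))
      = PadicInt.toZMod (B v w)) :
    (∀ G : Subgroup (Sp B), IsClosed[twoAdic B] (G : Set (Sp B)) →
      stdImage B d e ≤ G.map (redSp B 2) →
        (6 ≤ d → Even d →
          G = (G.map (redSp B 2)).comap (redSp B 2) ∧
          IsOpen[twoAdic B] (G : Set (Sp B)) ∧ Gam B 2 ≤ G) ∧
        (5 ≤ d → Odd d →
          Gam B 8 ≤ G ∧ IsOpen[twoAdic B] (G : Set (Sp B)) ∧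
          (G.map (redSp B 2) = stdImage B d e → ¬ Gam B 4 ≤ G →
            Nat.card (G.map (redSp B 8)) = Nat.factorial d * 2 ^ (4 * g ^ 2 - 2 * g)))) ∧
    (5 ≤ d → Odd d → ∀ G H : Subgroup (Sp B),
      IsClosed[twoAdic B] (G : Set (Sp B)) → IsClosed[twoAdic B] (H : Set (Sp B)) →
      G.map (redSp B 2) = stdImage B d e → H.map (redSp B 2) = stdImage B d e →
      ¬ Gam B 4 ≤ G → ¬ Gam B 4 ≤ H →
        ∃ u ∈ (stdImage B d e).comap (redSp B 2),
          H = G.map (MulAut.conj u).toMonoidHom) := by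
  have he' : ∀ v w : V, stdForm d (redVec e v) (redVec e w) = PadicInt.toZMod (B v w) := he
  have hlifts : ∀ G : Subgroup (Sp B), G.map (redSp B 2) = stdImage B d e →
      (∀ g ∈ G, ∃ σ, Lifts e g σ) ∧ ∀ σ, ∃ g ∈ G, Lifts e g σ := fun G hG =>
    ⟨fun g hg => redSp_mem_stdImage_iff.1 (hG ▸ Subgroup.mem_map_of_mem _ hg),
      exists_lifts hB he' hG.ge⟩
  refine ⟨fun G hGc hGi => ⟨fun hd6 heven => ?_, fun hd5 hodd => ?_⟩, ?_⟩
  · have hGs := exists_lifts hB he' hGi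
    have h2 := Gam_two_le (by omega) he' hGs hGc
      (symEnd_le_layer_zero (by omega) heven hB he' hGs)
    refine ⟨?_, isOpen_of_Gam_le 1 h2, h2⟩
    rw [Subgroup.comap_map_eq]
    exact (sup_eq_left.2 h2).symm
  · have hGs := exists_lifts hB he' hGi
    have h8 : Gam B (2 ^ 3) ≤ G := by
      by_cases hG4 : Gam B (2 ^ 2) ≤ G
      · exact (Gam_antitone (by omega)).trans hG4
      · exact (layers_of_not_Gam_four_le hd5 hodd hB he' hGs hGc hG4).2.2
    refine ⟨h8, isOpen_of_Gam_le 3 h8, fun hGe hG4 => ?_⟩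
    obtain ⟨h0, h1, -⟩ := layers_of_not_Gam_four_le hd5 hodd hB he' hGs hGc hG4
    refine card_map_redSp_eight hd5 hodd ?_ (hlifts G hGe).1 hGs h0 h1
    obtain ⟨k, rfl⟩ := hodd
    omega
  · intro hd5 hodd G H hGc hHc hGe hHe hG4 hH4
    obtain ⟨hGl, hGs⟩ := hlifts G hGe
    obtain ⟨hHl, hHs⟩ := hlifts H hHe
    obtain ⟨hG0, hG1, hG8⟩ := layers_of_not_Gam_four_le hd5 hodd hB he' hGs hGc hG4
    obtain ⟨hH0, hH1, hH8⟩ := layers_of_not_Gam_four_le hd5 hodd hB he' hHs hHc hH4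
    obtain ⟨u, hu, huG⟩ := exists_conj_eq hd5 hodd hB he' hGl hGs hHl hHs hG0 hG1 hH0 hH1 hG8 hH8
    exact ⟨u, redSp_mem_stdImage_iff.2 ⟨1, lifts_one_iff.2 hu⟩, huG⟩
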